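/- Let $K$ be a field, let $q\in K$ be nonzero and not a root of unity, let $V=K^N$, and put $k_q=(q^k-q^{-k})/(q-q^{-1})$. Let $\hat R\in \mathrm{End}(V\otimes V)$ be a Yang–Baxter matrix of Hecke type. That is, writing $\hat R_i$ for $\hat R$ acting in the $i$-th and $(i+1)$-st copies of $V$, one has $\hat R_1\hat R_2\hat R_1=\hat R_2\hat R_1\hat R_2$ on $V^{\otimes 3}$, and $\hat R=qS-q^{-1}A$, where $S$ and $A$ are complementary projectors ($S^2=S$, $A^2=A$, $SA=AS=0$, $S+A=I$). No condition is imposed on the ranks of $S$ and $A$. Assume that the equation $$\mathrm{Tr}_2(\hat R D_2)=I$$ has exactly one solution $D\in\mathrm{End}(V)$ (where $D_2=I\otimes D$). Write $\mathrm{Tr}_q$ for the trace weighted by $D$: $\mathrm{Tr}_{q\,(a\dots b)}(Z)=\mathrm{Tr}_{(a\dots b)}(D_a\cdots D_b Z)$, where the trace is taken over the copies $a,\dots,b$ of $V$. Define the antisymmetrizers by $A_1=I$ and $$A_k=\frac1{k_q}A_{k-1}\bigl(q^{k-1}-(k-1)_q\hat R_{k-1}\bigr)A_{k-1}.$$ The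 RLRL-algebra (reflection equation algebra) is the unital associative $K$-algebra generated by the entries of an $N\times N$ matrix $L$ subject to the relations $\hat R L_1\hat R L_1=L_1\hat R L_1\hat R$, where $L_1=L\otimes I$. Define $$L_{\overline 1}=L_1,\qquad L_{\overline k}=\hat R_{k-1}L_{\overline{k-1}}\hat R_{k-1}^{-1},$$ and, for $k\ge1$ and $j\ge 1$, $$L^{[k]}=\mathrm{Tr}_{q\,(2\dots k)}\bigl(A_kL_{\overline1}\cdots L_{\overline k}\bigr),\qquad \sigma_0(L)=1,\qquad \sigma_j(L)=q^j\,\mathrm{Tr}_{q\,(1\dots j)}\bigl(A_jL_{\overline1}\cdots L_{\overline j}\bigr).$$ Then for all $k\ge1$ $$k_q\,L^{[k]}=-\sum_{j=0}^{k-1}\sigma_j(L)\,(-L)^{k-j},$$ where $(-L)^{k-j}$ is the usual matrix power, and every $\sigma_j(L)$, $j\ge0$, is central in the RLRL-algebra. -/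

import Mathlib

open scoped Kronecker

noncomputable section

namespace QCHN

universe u v w

section TensorOperators

variable {ι : Type v} [Fintype ι] [DecidableEq ι] {B : Type w}

/-- `Z ⊗ I`: an operator on `V^{⊗ n}` acting in the first `n` copies of `V^{⊗ (n+1)}`.
An operator on `V^{⊗ n}` is a matrix whose rows (upper indices) and columns (lower indices) are
labelled by words `Fin n → ι`. -/
def extend [Zero B] {n : ℕ} (Z : Matrix (Fin n → ι) (Fin n → ι) B) :
    Matrix (Fin (n + 1) → ι) (Fin (n + 1) → ι) B :=
  Matrix.of fun x y =>
    if x (Fin.last n) = y (Fin.last n) then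
      Z (fun c => x c.castSucc) (fun c => y c.castSucc)
    else 0

/-- The operator `M` on `V ⊗ V` acting in the last two copies of `V^{⊗ (n+2)}`, that is, in the
copies number `n+1` and `n+2`. For `M = R̂` this is `R̂_{n+1}`. -/
def lastTwo [Zero B] (n : ℕ) (M : Matrix (ι × ι) (ι × ι) B) :
    Matrix (Fin (n + 2) → ι) (Fin (n + 2) → ι) B :=
  Matrix.of fun x y =>
    if ∀ c : Fin n, x c.castSucc.castSucc = y c.castSucc.castSucc then
      M (x (Fin.last n).castSucc, x (Fin.last (n + 1)))
        (y (Fin.last n).castSucc, y (Fin.last (n + 1)))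
    else 0

/-- The partial trace over the second copy of an operator on `V ⊗ V`. -/
def traceSecond [AddCommMonoid B] (M : Matrix (ι × ι) (ι × ι) B) : Matrix ι ι B :=
  Matrix.of fun i k => ∑ j, M (i, j) (k, j)

end TensorOperators

section RMatrix

variable {K : Type u} [Field K] {ι : Type v} [Fintype ι] [DecidableEq ι]

/-- The Yang-Baxter equation `R̂₁ R̂₂ R̂₁ = R̂₂ R̂₁ R̂₂` on `V ⊗ V ⊗ V`. -/
def IsYangBaxter (R : Matrix (ι × ι) (ι × ι) K) : Prop :=
  extend (lastTwo 0 R) * lastTwo 1 R * extend (lastTwo 0 R) =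
    lastTwo 1 R * extend (lastTwo 0 R) * lastTwo 1 R

/-- Hecke type: `R̂ = q S - q⁻¹ A` with complementary projectors `S` and `A`. -/
def IsHecke (q : K) (R : Matrix (ι × ι) (ι × ι) K) : Prop :=
  ∃ S A : Matrix (ι × ι) (ι × ι) K,
    S * S = S ∧ A * A = A ∧ S * A = 0 ∧ A * S = 0 ∧ S + A = 1 ∧ R = q • S - q⁻¹ • A

/-- `D` is the matrix defined by the equation `Tr₂(R̂ D₂) = I`: it is the unique solution of this
(square, linear) system. -/
def IsQTraceMatrix (R : Matrix (ι × ι) (ι × ι) K) (D : Matrix ι ι K) : Prop :=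
  traceSecond (R * ((1 : Matrix ι ι K) ⊗ₖ D)) = 1 ∧
    ∀ D' : Matrix ι ι K, traceSecond (R * ((1 : Matrix ι ι K) ⊗ₖ D')) = 1 → D' = D

/-- The `q`-number `k_q = (q^k - q^{-k}) / (q - q⁻¹)`. -/
def qNumber (q : K) (k : ℕ) : K := (q ^ k - q⁻¹ ^ k) / (q - q⁻¹)

/-- `antisymmetrizer q R n` is the `q`-antisymmetrizer `A_{n+1}` on `V^{⊗ (n+1)}`: `A₁ = I` and
`A_k = (1 / k_q) A_{k-1} (q^{k-1} - (k-1)_q R̂_{k-1}) A_{k-1}`. -/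
def antisymmetrizer (q : K) (R : Matrix (ι × ι) (ι × ι) K) :
    (n : ℕ) → Matrix (Fin (n + 1) → ι) (Fin (n + 1) → ι) K
  | 0 => 1
  | n + 1 =>
      (qNumber q (n + 2))⁻¹ •
        (extend (antisymmetrizer q R n) *
          (q ^ (n + 1) • (1 : Matrix (Fin (n + 2) → ι) (Fin (n + 2) → ι) K)
            - qNumber q (n + 1) • lastTwo n R) *
          extend (antisymmetrizer q R n))

end RMatrix

section QuantumMatrices

variable {K : Type u} [Field K] {ι : Type v} [Fintype ι] [DecidableEq ι]
variable {B : Type w} [Ring B] [Algebra K B]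

/-- A numerical matrix regarded as a matrix over the `K`-algebra `B`. -/
def scalars (B : Type w) [Ring B] [Algebra K B] {X : Type*} (M : Matrix X X K) :
    Matrix X X B :=
  M.map (algebraMap K B)

/-- `rlrlLeft R L = R̂ L₁ R̂ L₁`. -/
def rlrlLeft (R : Matrix (ι × ι) (ι × ι) K) (L : Matrix ι ι B) : Matrix (ι × ι) (ι × ι) B :=
  scalars B R * (L ⊗ₖ (1 : Matrix ι ι B)) * scalars B R * (L ⊗ₖ (1 : Matrix ι ι B))

/-- `rlrlRight R L = L₁ R̂ L₁ R̂`. -/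
def rlrlRight (R : Matrix (ι × ι) (ι × ι) K) (L : Matrix ι ι B) : Matrix (ι × ι) (ι × ι) B :=
  (L ⊗ₖ (1 : Matrix ι ι B)) * scalars B R * (L ⊗ₖ (1 : Matrix ι ι B)) * scalars B R

/-- `Lbar R L n` is the matrix `L_{\bar{n+1}}` on `V^{⊗ (n+1)}`: `L_{\bar 1} = L₁` and
`L_{\bar k} = R̂_{k-1} L_{\bar{k-1}} R̂_{k-1}⁻¹`. -/
def Lbar (R : Matrix (ι × ι) (ι × ι) K) (L : Matrix ι ι B) :
    (n : ℕ) → Matrix (Fin (n + 1) → ι) (Fin (n + 1) → ι) B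
  | 0 => Matrix.of fun x y => L (x 0) (y 0)
  | n + 1 => scalars B (lastTwo n R) * extend (Lbar R L n) * scalars B (lastTwo n R⁻¹)

/-- `LbarProd R L n` is the ordered product `L_{\bar 1} L_{\bar 2} ⋯ L_{\bar{n+1}}` on
`V^{⊗ (n+1)}`. -/
def LbarProd (R : Matrix (ι × ι) (ι × ι) K) (L : Matrix ι ι B) :
    (n : ℕ) → Matrix (Fin (n + 1) → ι) (Fin (n + 1) → ι) B
  | 0 => Lbar R L 0
  | n + 1 => extend (LbarProd R L n) * Lbar R L (n + 1)

/-- The `q`-trace over all copies: `Tr(D₁ D₂ ⋯ D_n Z)`. -/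
def qTrace (D : Matrix ι ι K) {n : ℕ} (Z : Matrix (Fin n → ι) (Fin n → ι) B) : B :=
  ∑ x : Fin n → ι, ∑ y : Fin n → ι, (∏ c, D (x c) (y c)) • Z y x

/-- The `q`-trace over all copies but the first: `Tr_{(2 … n+1)}(D₂ ⋯ D_{n+1} Z)`. -/
def qTraceTail (D : Matrix ι ι K) {n : ℕ}
    (Z : Matrix (Fin (n + 1) → ι) (Fin (n + 1) → ι) B) : Matrix ι ι B :=
  Matrix.of fun i j =>
    ∑ x : Fin n → ι, ∑ y : Fin n → ι,
      (∏ c, D (x c) (y c)) • Z (Fin.cons i y) (Fin.cons j x)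

/-- `wedgePower q R D L n` is the wedge power
`L^{[n+1]} = Tr_q_{(2 … n+1)}(A_{n+1} L_{\bar 1} ⋯ L_{\bar{n+1}})`. -/
def wedgePower (q : K) (R : Matrix (ι × ι) (ι × ι) K) (D : Matrix ι ι K) (L : Matrix ι ι B)
    (n : ℕ) : Matrix ι ι B :=
  qTraceTail D (scalars B (antisymmetrizer q R n) * LbarProd R L n)

/-- The elementary symmetric functions `σ_0(L) = 1` and, for `j ≥ 1`,
`σ_j(L) = q^j Tr_q_{(1 … j)}(A_j L_{\bar 1} ⋯ L_{\bar j})`. -/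
def sigma (q : K) (R : Matrix (ι × ι) (ι × ι) K) (D : Matrix ι ι K) (L : Matrix ι ι B) :
    ℕ → B
  | 0 => 1
  | n + 1 => q ^ (n + 1) • qTrace D (scalars B (antisymmetrizer q R n) * LbarProd R L n)

end QuantumMatrices

section RLRLAlgebra

variable {K : Type u} [Field K] {ι : Type v} [Fintype ι] [DecidableEq ι]

/-- The matrix of free generators. -/
def freeMatrix (K : Type u) [Field K] (ι : Type v) : Matrix ι ι (FreeAlgebra K (ι × ι)) :=
  Matrix.of fun i j => FreeAlgebra.ι K (i, j)

/-- The entries of the defining relation `R̂ L₁ R̂ L₁ = L₁ R̂ L₁ R̂`. -/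
inductive RLRLRel (R : Matrix (ι × ι) (ι × ι) K) :
    FreeAlgebra K (ι × ι) → FreeAlgebra K (ι × ι) → Prop
  | entry (a b : ι × ι) :
      RLRLRel R (rlrlLeft R (freeMatrix K ι) a b) (rlrlRight R (freeMatrix K ι) a b)

/-- The RLRL-algebra (reflection equation algebra): the unital associative `K`-algebra generated
by the entries of a matrix `L` subject to `R̂ L₁ R̂ L₁ = L₁ R̂ L₁ R̂`. -/
abbrev RLRLAlgebra (R : Matrix (ι × ι) (ι × ι) K) := RingQuot (RLRLRel R)

/-- The generating matrix `L` of the RLRL-algebra. -/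
def generatingMatrix (R : Matrix (ι × ι) (ι × ι) K) : Matrix ι ι (RLRLAlgebra R) :=
  Matrix.of fun i j => RingQuot.mkAlgHom K (RLRLRel R) (FreeAlgebra.ι K (i, j))

end RLRLAlgebra

end QCHN

end

/-! Write `P_k` for the product of the first `k` matrices `L_{\bar i}`, and `A'` for the
antisymmetrizer in copies `2, …, k`. Antisymmetrizers do not change when their generators are
reversed (`IsHeckeFamily.antisym_reverse`), so `k_q A_k = A' (q^{k-1} - (k-1)_q R̂₁) A'`. The
reflection equation makes each `R̂_i` with `i < k` commute with `P_k`
(`IsReflectionFamily.commute_barProd`), hence so does `A'`. As `D ⊗ D` commutes with `R̂`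
(`IsQTraceMatrix.kronecker_commute`), `A'` is also cyclic under the trace over copies `2, …, k`.
Therefore `k_q L^{[k]} = q^{k-1} Tr(A' P_k) - (k-1)_q Tr(A' R̂₁ P_k)`.

For the first trace put `U = R̂₁ ⋯ R̂_{k-1}` and `W = R̂_{k-1} ⋯ R̂₁`. Then `A' P_k` equals both `L₁
(U A_{k-1} P_{k-1} U⁻¹)` and `(W⁻¹ A_{k-1} P_{k-1} W) L₁`. Each conjugate has partial trace the full
trace of `A_{k-1} P_{k-1}` times the identity (`qTraceTail_conj_wordUp`,
`qTraceTail_conj_wordDown`). So that full trace commutes with the entries of `L`, which is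
centrality, and the first term is `σ_{k-1} L`.

For the second trace, `R̂₁ P_k = L₁ U P_{k-1} (R̂₂ ⋯ R̂_{k-1})⁻¹`. The inverse word is cycled into
`A'`, which absorbs it; `A' U = U A_{k-1}`; the equation `Tr₂(R̂ D₂) = I` removes the last letter of
`U`; and `A_{k-1}` absorbs the others. The scalars cancel, leaving `L L^{[k-1]}`. The recursion `k_q
L^{[k]} = σ_{k-1} L - (k-1)_q L L^{[k-1]}` (`wedgePower_succ`) is then iterated.

Uniqueness of `D` enters as injectivity of `Y ↦ Tr₂(R̂ Y₂)`, through which the exchange rule for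
conjugates and the commutation of `D ⊗ D` with `R̂` are verified. -/

noncomputable section

namespace QCHN

universe u v w

/-! ### Antisymmetrizers in an abstract Hecke algebra -/

section HeckeAlgebra

variable {K : Type*} [Field K] {H : Type*} [Ring H] [Algebra K H]

/-- The elements `g 0, …, g (n - 1)` satisfy the relations of the Hecke algebra with parameter
`q`. -/
structure IsHeckeFamily (q : K) (g : ℕ → H) (n : ℕ) : Prop where
  quad : ∀ i < n, g i * g i = (q - q⁻¹) • g i + 1
  braid : ∀ i, i + 1 < n → g i * g (i + 1) * g i = g (i + 1) * g i * g (i + 1)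
  comm : ∀ i j, i + 1 < j → j < n → g i * g j = g j * g i

/-- The antisymmetrizer in the elements `g 0, …, g (n - 1)`. -/
def antisym (q : K) (g : ℕ → H) : ℕ → H
  | 0 => 1
  | n + 1 => (qNumber q (n + 2))⁻¹ •
      (antisym q g n * (q ^ (n + 1) • (1 : H) - qNumber q (n + 1) • g n) * antisym q g n)

section QNumbers

variable {q : K}

lemma sub_inv_ne_zero (hq0 : q ≠ 0) (hq : ∀ n : ℕ, 1 ≤ n → q ^ n ≠ 1) : q - q⁻¹ ≠ 0 := by
  intro h
  apply hq 2 (by norm_num)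
  field_simp at h
  linear_combination h

lemma qNumber_ne_zero (hq0 : q ≠ 0) (hq : ∀ n : ℕ, 1 ≤ n → q ^ n ≠ 1) (n : ℕ) :
    qNumber q (n + 1) ≠ 0 := by
  refine div_ne_zero (fun h => hq (2 * (n + 1)) (by omega) ?_) (sub_inv_ne_zero hq0 hq)
  have h1 : q ^ (n + 1) * q⁻¹ ^ (n + 1) = 1 := by
    rw [← mul_pow, mul_inv_cancel₀ hq0, one_pow]
  rw [two_mul, pow_add]
  linear_combination q ^ (n + 1) * h + h1

lemma qNumber_one (hs : q - q⁻¹ ≠ 0) : qNumber q 1 = 1 := by simp [qNumber, hs]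

lemma qNumber_succ (hq0 : q ≠ 0) (hs : q - q⁻¹ ≠ 0) (n : ℕ) :
    qNumber q (n + 1) = q ^ n + qNumber q n * q⁻¹ := by
  have h1 : q * q⁻¹ = 1 := mul_inv_cancel₀ hq0
  rw [qNumber, qNumber, div_eq_iff hs, add_mul, mul_right_comm, div_mul_cancel₀ _ hs]
  ring

lemma qNumber_add_two (hq0 : q ≠ 0) (n : ℕ) :
    qNumber q (n + 2) = (q + q⁻¹) * qNumber q (n + 1) - qNumber q n := by
  have h1 : q * q⁻¹ = 1 := mul_inv_cancel₀ hq0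
  simp only [qNumber]
  rw [mul_div_assoc', ← sub_div]
  congr 1
  linear_combination (q⁻¹ ^ n - q ^ n) * h1

end QNumbers

variable {q : K} {g g' : ℕ → H} {n : ℕ}

lemma IsHeckeFamily.mono {m : ℕ} (h : IsHeckeFamily q g n) (hm : m ≤ n) :
    IsHeckeFamily q g m where
  quad i hi := h.quad i (by omega)
  braid i hi := h.braid i (by omega)
  comm i j hij hj := h.comm i j hij (by omega)

lemma IsHeckeFamily.shift (h : IsHeckeFamily q g (n + 1)) :
    IsHeckeFamily q (fun i => g (i + 1)) n where
  quad i hi := h.quad _ (by omega)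
  braid i hi := h.braid _ (by omega)
  comm i j hij hj := h.comm _ _ (by omega) (by omega)

lemma IsHeckeFamily.reverse (h : IsHeckeFamily q g (n + 1)) :
    IsHeckeFamily q (fun i => g (n - i)) (n + 1) where
  quad i hi := h.quad _ (by omega)
  braid i hi := by
    have := h.braid (n - (i + 1)) (by omega)
    rw [show n - (i + 1) + 1 = n - i by omega] at this
    exact this.symm
  comm i j hij hj := (h.comm _ _ (by omega) (by omega)).symm

lemma antisym_congr (q : K) (h : ∀ i < n, g i = g' i) : antisym q g n = antisym q g' n := by
  induction n with
  | zero => rfl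
  | succ n ih => rw [antisym, antisym, ih fun i hi => h i (by omega), h n (by omega)]

lemma map_antisym {H' : Type*} [Ring H'] [Algebra K H'] (f : H →ₐ[K] H') (q : K) (g : ℕ → H)
    (n : ℕ) : f (antisym q g n) = antisym q (fun i => f (g i)) n := by
  induction n with
  | zero => simp [antisym]
  | succ n ih => simp [antisym, ih]

lemma antisym_mem (S : Subalgebra K H) (q : K) (h : ∀ i < n, g i ∈ S) : antisym q g n ∈ S := by
  induction n with
  | zero => exact S.one_mem
  | succ n ih =>
    have ih := ih fun i hi => h i (by omega)
    exact S.smul_mem (S.mul_mem (S.mul_mem ih (S.sub_mem (S.smul_mem S.one_mem _)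
      (S.smul_mem (h n (by omega)) _))) ih) _

lemma antisym_semiconj {x : H} (h : ∀ i < n, SemiconjBy x (g i) (g' i)) :
    SemiconjBy x (antisym q g n) (antisym q g' n) := by
  induction n with
  | zero => exact SemiconjBy.one_right x
  | succ n ih =>
    have ih := ih fun i hi => h i (by omega)
    have h1 : SemiconjBy x (q ^ (n + 1) • (1 : H) - qNumber q (n + 1) • g n)
        (q ^ (n + 1) • (1 : H) - qNumber q (n + 1) • g' n) := by
      have := (h n (by omega)).eq
      simp only [SemiconjBy, mul_sub, sub_mul, mul_smul_comm, smul_mul_assoc, this, mul_one,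
        one_mul]
    have h2 := ((ih.mul_right h1).mul_right ih).eq
    simp only [SemiconjBy, antisym, mul_smul_comm, smul_mul_assoc, h2]

lemma antisym_commute {x : H} (h : ∀ i < n, Commute x (g i)) : Commute x (antisym q g n) :=
  antisym_semiconj h

/-- On the eigenvalue `-q⁻¹` the middle factor becomes `q^{n+1} + (n+1)_q q⁻¹ = (n+2)_q`, which
cancels the prefactor. No relation among the `g i` is needed, so the lemma can compare
antisymmetrizers built in different ways. -/
lemma antisym_mul_of_absorb (hq0 : q ≠ 0) (hq : ∀ n : ℕ, 1 ≤ n → q ^ n ≠ 1) {x : H}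
    (h : ∀ i < n, g i * x = (-q⁻¹) • x) : antisym q g n * x = x := by
  induction n with
  | zero => simp [antisym]
  | succ n ih =>
    have ih := ih fun i hi => h i (by omega)
    rw [antisym, smul_mul_assoc, mul_assoc, ih, mul_assoc, sub_mul, smul_mul_assoc, smul_mul_assoc,
      h n (by omega), one_mul, smul_smul, ← sub_smul, mul_smul_comm, ih, smul_smul]
    rw [show q ^ (n + 1) - qNumber q (n + 1) * -q⁻¹ = qNumber q (n + 2) by
      rw [qNumber_succ hq0 (sub_inv_ne_zero hq0 hq) (n + 1)]; ring,
      inv_mul_cancel₀ (qNumber_ne_zero hq0 hq _), one_smul]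

lemma mul_antisym_of_absorb (hq0 : q ≠ 0) (hq : ∀ n : ℕ, 1 ≤ n → q ^ n ≠ 1) {x : H}
    (h : ∀ i < n, x * g i = (-q⁻¹) • x) : x * antisym q g n = x := by
  induction n with
  | zero => simp [antisym]
  | succ n ih =>
    have ih := ih fun i hi => h i (by omega)
    rw [antisym, mul_smul_comm, ← mul_assoc, ← mul_assoc, ih, mul_sub, mul_smul_comm, mul_smul_comm,
      h n (by omega), mul_one, smul_smul, ← sub_smul, smul_mul_assoc, ih, smul_smul]
    rw [show q ^ (n + 1) - qNumber q (n + 1) * -q⁻¹ = qNumber q (n + 2) by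
      rw [qNumber_succ hq0 (sub_inv_ne_zero hq0 hq) (n + 1)]; ring,
      inv_mul_cancel₀ (qNumber_ne_zero hq0 hq _), one_smul]

/-- The computation behind the absorption property: `s` and `t` are `g n + q⁻¹` and
`g (n - 1) + q⁻¹`. -/
lemma absorb_step (hq0 : q ≠ 0) {s t a : H} (n : ℕ) (hs : s * s = (q + q⁻¹) • s)
    (hst : s * t * s - s = t * s * t - t) (ha : t * a = 0) :
    s * (qNumber q (n + 1) • 1 - qNumber q n • t) *
      (qNumber q (n + 2) • 1 - qNumber q (n + 1) • s) * a = 0 := by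
  have h1 : s * t * s * a = s * a := by
    have := congrArg (· * a) hst
    simp only [sub_mul, mul_assoc, ha, mul_zero, sub_zero] at this
    rw [mul_assoc, mul_assoc]
    exact sub_eq_zero.1 this
  have h2 : s * t * a = 0 := by rw [mul_assoc, ha, mul_zero]
  have h3 : s * s * a = (q + q⁻¹) • (s * a) := by rw [hs, smul_mul_assoc]
  simp only [mul_sub, sub_mul, smul_mul_assoc, mul_smul_comm, mul_one, h1, h2, h3,
    smul_zero, smul_sub, smul_smul, ← sub_smul, sub_zero]
  rw [qNumber_add_two hq0]
  have : ∀ c : K, c = 0 → c • (s * a) = 0 := by rintro _ rfl; simp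
  apply this
  ring

/-- Induction on `n`. A lower generator is absorbed by the left outer factor of the recursion. For
the top one, `g + q⁻¹` must annihilate the antisymmetrizer, which comes down to the three-term
recursion of the `q`-numbers. -/
theorem IsHeckeFamily.mul_antisym (hq0 : q ≠ 0) (hq : ∀ n : ℕ, 1 ≤ n → q ^ n ≠ 1)
    (h : IsHeckeFamily q g n) : ∀ i < n, g i * antisym q g n = (-q⁻¹) • antisym q g n := by
  have hs := sub_inv_ne_zero hq0 hq
  have hqi : q * q⁻¹ = 1 := mul_inv_cancel₀ hq0
  induction n with
  | zero => intro i hi; omega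
  | succ n ih =>
    have ih := ih (h.mono (Nat.le_succ n))
    intro i hi
    rcases Nat.lt_succ_iff_lt_or_eq.1 hi with hi | rfl
    · rw [antisym, mul_smul_comm, ← mul_assoc, ← mul_assoc, ih i hi, smul_mul_assoc,
        smul_mul_assoc, smul_comm]
    have hS : ∀ j < i + 1, (g j + q⁻¹ • 1) * (g j + q⁻¹ • 1) = (q + q⁻¹) • (g j + q⁻¹ • 1) := by
      intro j hj
      simp only [add_mul, mul_add, h.quad j hj, smul_mul_assoc, mul_smul_comm, mul_one, one_mul,
        smul_add, smul_smul, add_smul, sub_smul, hqi, one_smul]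
      abel
    suffices hz : (g i + q⁻¹ • 1) * antisym q g (i + 1) = 0 by
      rw [add_mul, smul_mul_assoc, one_mul] at hz
      rw [neg_smul]
      exact eq_neg_of_add_eq_zero_left hz
    rcases i with _ | m
    · have h1 : q ^ 1 • (1 : H) - qNumber q 1 • g 0 = (q + q⁻¹) • 1 - (g 0 + q⁻¹ • 1) := by
        rw [qNumber_one hs, add_smul, pow_one, one_smul]; abel
      simp only [antisym, zero_add, one_mul, mul_one, mul_smul_comm]
      rw [h1, mul_sub, mul_smul_comm, mul_one, hS 0 (by omega), sub_self, smul_zero]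
    set a := antisym q g (m + 1) with ha
    set b := antisym q g m with hb
    set s := g (m + 1) + q⁻¹ • (1 : H) with hs'
    set t := g m + q⁻¹ • (1 : H) with ht'
    have hc : ∀ j k : ℕ, q ^ (k + 1) • (1 : H) - qNumber q (k + 1) • g j =
        qNumber q (k + 2) • 1 - qNumber q (k + 1) • (g j + q⁻¹ • 1) := by
      intro j k
      rw [qNumber_succ hq0 hs (k + 1), add_smul, smul_add, smul_smul]; abel
    have hta : t * a = 0 := by
      rw [ht', add_mul, ih m (by omega), smul_mul_assoc, one_mul, neg_smul, neg_add_cancel]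
    -- The braid relation for `g m`, `g (m + 1)` rewritten for the shifted generators `t`, `s`.
    have hst : s * t * s - s = t * s * t - t := by
      have hb := h.braid m (by omega)
      have e1 : t * s * t - s * t * s = t - s := by
        simp only [hs', ht', add_mul, mul_add, smul_mul_assoc, mul_smul_comm, mul_one, one_mul,
          hb, h.quad m (by omega), h.quad (m + 1) (by omega), smul_add, smul_smul, sub_smul,
          smul_sub]
        have e2 : q⁻¹ * q = 1 := inv_mul_cancel₀ hq0
        simp only [e2, one_smul]
        abel
      rw [sub_eq_sub_iff_sub_eq_sub] at e1 ⊢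
      rw [← neg_sub (t * s * t), sub_eq_iff_eq_add.1 e1]
      abel
    have hbs : s * b = b * s := by
      have : Commute s b := antisym_commute fun i hi => by
        have h2 : Commute (g (m + 1)) (g i) := (h.comm i (m + 1) (by omega) (by omega)).symm
        exact h2.add_left ((Commute.one_left _).smul_left _)
      exact this.eq
    have hba : b * a = a := antisym_mul_of_absorb hq0 hq fun i hi => ih i (by omega)
    have key := absorb_step hq0 (m + 1) (hS (m + 1) (by omega)) hst hta
    have hav : a = (qNumber q (m + 2))⁻¹ •
        (b * (qNumber q (m + 2) • 1 - qNumber q (m + 1) • t) * b) := by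
      rw [ha, antisym, hc]
    rw [antisym, hc, ← ha, mul_smul_comm]
    -- Expand the left `a` as `b (⋯ t) b`. Both `b`s move outwards because `s` commutes with `b`,
    -- and the right one disappears in `b * a = a`; the rest is `absorb_step`.
    rw [show s * (a * (qNumber q (m + 3) • 1 - qNumber q (m + 2) • s) * a) =
      (qNumber q (m + 2))⁻¹ • (b * (s * (qNumber q (m + 2) • 1 - qNumber q (m + 1) • t) *
        (qNumber q (m + 3) • 1 - qNumber q (m + 2) • s) * a)) from ?_, key, mul_zero, smul_zero,
      smul_zero]
    have hbd : b * (qNumber q (m + 3) • 1 - qNumber q (m + 2) • s) =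
        (qNumber q (m + 3) • 1 - qNumber q (m + 2) • s) * b := by
      rw [mul_sub, sub_mul, mul_smul_comm, mul_smul_comm, smul_mul_assoc, smul_mul_assoc, hbs,
        mul_one, one_mul]
    nth_rewrite 1 [hav]
    simp only [smul_mul_assoc, mul_smul_comm]
    congr 1
    calc _ = (s * b) * (qNumber q (m + 2) • 1 - qNumber q (m + 1) • t) *
          (b * (qNumber q (m + 3) • 1 - qNumber q (m + 2) • s)) * a := by simp only [mul_assoc]
      _ = (b * s) * (qNumber q (m + 2) • 1 - qNumber q (m + 1) • t) *
          (qNumber q (m + 3) • 1 - qNumber q (m + 2) • s) * (b * a) := by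
        rw [hbs, hbd]; simp only [mul_assoc]
      _ = _ := by rw [hba]; simp only [mul_assoc]

/-- The recursion is palindromic, so it survives passing to the opposite ring; right absorption is
thus left absorption there. -/
lemma op_antisym (q : K) (g : ℕ → H) (n : ℕ) :
    MulOpposite.op (antisym q g n) = antisym q (fun i => MulOpposite.op (g i)) n := by
  induction n with
  | zero => rfl
  | succ n ih => simp only [antisym, MulOpposite.op_smul, MulOpposite.op_mul, ih,
      MulOpposite.op_sub, MulOpposite.op_one, mul_assoc]

lemma IsHeckeFamily.op (h : IsHeckeFamily q g n) :
    IsHeckeFamily q (fun i => MulOpposite.op (g i)) n where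
  quad i hi := by
    rw [← MulOpposite.op_mul, h.quad i hi, MulOpposite.op_add, MulOpposite.op_smul,
      MulOpposite.op_one]
  braid i hi := by
    have := h.braid i hi
    simp only [← MulOpposite.op_mul, ← mul_assoc, this]
  comm i j hij hj := by simp only [← MulOpposite.op_mul, h.comm i j hij hj]

theorem IsHeckeFamily.antisym_mul (hq0 : q ≠ 0) (hq : ∀ n : ℕ, 1 ≤ n → q ^ n ≠ 1)
    (h : IsHeckeFamily q g n) (i : ℕ) (hi : i < n) :
    antisym q g n * g i = (-q⁻¹) • antisym q g n := by
  have := h.op.mul_antisym hq0 hq i hi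
  rw [← op_antisym, ← MulOpposite.op_mul, ← MulOpposite.op_smul] at this
  exact MulOpposite.op_injective this

lemma IsHeckeFamily.antisym_mul_self (hq0 : q ≠ 0) (hq : ∀ n : ℕ, 1 ≤ n → q ^ n ≠ 1)
    (h : IsHeckeFamily q g n) : antisym q g n * antisym q g n = antisym q g n :=
  antisym_mul_of_absorb hq0 hq (h.mul_antisym hq0 hq)

/-- The product of the two antisymmetrizers equals each of them: the second absorbs the generators
on its left, the first on its right. -/
lemma IsHeckeFamily.antisym_reverse (hq0 : q ≠ 0) (hq : ∀ n : ℕ, 1 ≤ n → q ^ n ≠ 1)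
    (h : IsHeckeFamily q g (n + 1)) :
    antisym q (fun i => g (n - i)) (n + 1) = antisym q g (n + 1) := by
  have h1 : antisym q g (n + 1) * antisym q (fun i => g (n - i)) (n + 1) =
      antisym q (fun i => g (n - i)) (n + 1) := antisym_mul_of_absorb hq0 hq fun i hi => by
    have := h.reverse.mul_antisym hq0 hq (n - i) (by omega)
    rwa [show n - (n - i) = i by omega] at this
  rw [← h1]
  exact mul_antisym_of_absorb hq0 hq fun i hi => h.antisym_mul hq0 hq _ (by omega)

/-- The recursion for the antisymmetrizers built up from the last elements of the family. -/
theorem IsHeckeFamily.antisym_succ (hq0 : q ≠ 0) (hq : ∀ n : ℕ, 1 ≤ n → q ^ n ≠ 1)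
    (h : IsHeckeFamily q g (n + 1)) :
    antisym q g (n + 1) = (qNumber q (n + 2))⁻¹ • (antisym q (fun i => g (i + 1)) n *
      (q ^ (n + 1) • (1 : H) - qNumber q (n + 1) • g 0) * antisym q (fun i => g (i + 1)) n) := by
  have h1 : antisym q (fun i => g (n - i)) n = antisym q (fun i => g (i + 1)) n := by
    rcases n with _ | m
    · rfl
    rw [← h.shift.antisym_reverse hq0 hq]
    exact antisym_congr q fun i hi => by rw [show m + 1 - i = m - i + 1 by omega]
  rw [← h.antisym_reverse hq0 hq, antisym, h1, Nat.sub_self]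

end HeckeAlgebra

/-! ### Consequences of the reflection equation in an abstract ring -/

section ReflectionFamily

variable {H : Type*} [Ring H]

/-- The elements `L_{\bar 1} = ℓ`, `L_{\bar k+1} = g_k L_{\bar k} g_k⁻¹` of a ring. -/
def barElem (g : ℕ → Hˣ) (ℓ : H) : ℕ → H
  | 0 => ℓ
  | k + 1 => g k * barElem g ℓ k * ↑(g k)⁻¹

/-- The ordered products of the elements `barElem g ℓ 0, …, barElem g ℓ k`. -/
def barProd (g : ℕ → Hˣ) (ℓ : H) : ℕ → H
  | 0 => ℓ
  | k + 1 => barProd g ℓ k * barElem g ℓ (k + 1)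

/-- The word `g 0 * g 1 * ⋯ * g (k - 1)`. -/
def wordUp (g : ℕ → Hˣ) : ℕ → Hˣ
  | 0 => 1
  | k + 1 => wordUp g k * g k

/-- The word `g (k - 1) * ⋯ * g 1 * g 0`. -/
def wordDown (g : ℕ → Hˣ) : ℕ → Hˣ
  | 0 => 1
  | k + 1 => g k * wordDown g k

/-- The units `g 0, …, g (n - 1)` satisfy the braid relations and `ℓ` satisfies the reflection
equation with `g 0` and commutes with the others. -/
structure IsReflectionFamily (g : ℕ → Hˣ) (ℓ : H) (n : ℕ) : Prop where
  braid : ∀ i, i + 1 < n → (g i * g (i + 1) * g i : H) = g (i + 1) * g i * g (i + 1)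
  comm : ∀ i j, i + 1 < j → j < n → Commute (g i : H) (g j)
  comm_elem : ∀ i, 0 < i → i < n → Commute (g i : H) ℓ
  reflection : 0 < n → g 0 * ℓ * g 0 * ℓ = ℓ * g 0 * ℓ * g 0

variable {g g' : ℕ → Hˣ} {ℓ : H} {n : ℕ}

lemma barElem_congr (h : ∀ i < n, g i = g' i) : barElem g ℓ n = barElem g' ℓ n := by
  induction n with
  | zero => rfl
  | succ n ih => rw [barElem, barElem, ih fun i hi => h i (by omega), h n (by omega)]

lemma barProd_congr (h : ∀ i < n, g i = g' i) : barProd g ℓ n = barProd g' ℓ n := by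
  induction n with
  | zero => rfl
  | succ n ih => rw [barProd, barProd, ih fun i hi => h i (by omega), barElem_congr h]

lemma wordUp_congr (h : ∀ i < n, g i = g' i) : wordUp g n = wordUp g' n := by
  induction n with
  | zero => rfl
  | succ n ih => rw [wordUp, wordUp, ih fun i hi => h i (by omega), h n (by omega)]

lemma wordDown_congr (h : ∀ i < n, g i = g' i) : wordDown g n = wordDown g' n := by
  induction n with
  | zero => rfl
  | succ n ih => rw [wordDown, wordDown, ih fun i hi => h i (by omega), h n (by omega)]

section Map

variable {H' : Type*} [Ring H'] (f : H →* H')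

lemma map_barElem (k : ℕ) :
    f (barElem g ℓ k) = barElem (fun i => Units.map f (g i)) (f ℓ) k := by
  induction k with
  | zero => rfl
  | succ k ih => simp [barElem, ih, ← map_inv]

lemma map_barProd (k : ℕ) :
    f (barProd g ℓ k) = barProd (fun i => Units.map f (g i)) (f ℓ) k := by
  induction k with
  | zero => rfl
  | succ k ih => rw [barProd, barProd, map_mul, ih, map_barElem]

lemma map_wordUp (k : ℕ) :
    Units.map f (wordUp g k) = wordUp (fun i => Units.map f (g i)) k := by
  induction k with
  | zero => simp [wordUp]
  | succ k ih => simp [wordUp, ih]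

lemma map_wordDown (k : ℕ) :
    Units.map f (wordDown g k) = wordDown (fun i => Units.map f (g i)) k := by
  induction k with
  | zero => simp [wordDown]
  | succ k ih => simp [wordDown, ih]

end Map

lemma wordUp_succ' (g : ℕ → Hˣ) (k : ℕ) :
    wordUp g (k + 1) = g 0 * wordUp (fun i => g (i + 1)) k := by
  induction k with
  | zero => simp [wordUp]
  | succ k ih => rw [wordUp, ih, wordUp, mul_assoc]

lemma semiconj_barElem (g : ℕ → Hˣ) (ℓ : H) (k : ℕ) :
    SemiconjBy (wordDown g k : H) ℓ (barElem g ℓ k) := by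
  induction k with
  | zero => simp [wordDown, barElem, SemiconjBy]
  | succ k ih =>
    rw [wordDown, Units.val_mul]
    refine SemiconjBy.mul_left ?_ ih
    simp [SemiconjBy, barElem, mul_assoc]

namespace IsReflectionFamily

lemma commute_wordUp (h : IsReflectionFamily g ℓ n) {k j : ℕ} (hkj : k < j) (hj : j < n) :
    Commute (wordUp g k : H) (g j) := by
  induction k with
  | zero => exact Commute.one_left _
  | succ k ih =>
    rw [wordUp, Units.val_mul]
    exact (ih (by omega)).mul_left (h.comm _ _ hkj hj)

lemma commute_wordDown (h : IsReflectionFamily g ℓ n) {k j : ℕ} (hkj : k < j) (hj : j < n) :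
    Commute (wordDown g k : H) (g j) := by
  induction k with
  | zero => exact Commute.one_left _
  | succ k ih =>
    rw [wordDown, Units.val_mul]
    exact (h.comm _ _ hkj hj).mul_left (ih (by omega))

lemma semiconj_wordUp (h : IsReflectionFamily g ℓ n) {m i : ℕ} (hi : i + 1 < m) (hm : m ≤ n) :
    SemiconjBy (wordUp g m : H) (g i) (g (i + 1)) := by
  induction m with
  | zero => omega
  | succ m ih =>
    rw [wordUp, Units.val_mul]
    rcases Nat.lt_succ_iff_lt_or_eq.1 hi with hi | rfl
    · exact (ih hi (by omega)).mul_left (h.comm _ _ hi (by omega)).symm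
    · rw [wordUp, Units.val_mul, mul_assoc]
      refine (h.commute_wordUp (Nat.lt_succ_self i) (by omega)).semiconjBy.mul_left ?_
      simpa only [SemiconjBy, ← mul_assoc] using h.braid i (by omega)

lemma semiconj_wordDown (h : IsReflectionFamily g ℓ n) {m i : ℕ} (hi : i + 1 < m) (hm : m ≤ n) :
    SemiconjBy (wordDown g m : H) (g (i + 1)) (g i) := by
  induction m with
  | zero => omega
  | succ m ih =>
    rw [wordDown, Units.val_mul]
    rcases Nat.lt_succ_iff_lt_or_eq.1 hi with hi | rfl
    · exact SemiconjBy.mul_left (h.comm _ _ hi (by omega)).symm (ih hi (by omega))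
    · rw [wordDown, Units.val_mul, ← mul_assoc]
      refine SemiconjBy.mul_left ?_ (h.commute_wordDown (Nat.lt_succ_self i) (by omega))
      simpa only [SemiconjBy, ← mul_assoc] using (h.braid i (by omega)).symm

lemma commute_barElem_of_lt (h : IsReflectionFamily g ℓ n) {k j : ℕ} (hkj : k < j) (hj : j < n) :
    Commute (g j : H) (barElem g ℓ k) := by
  induction k with
  | zero => exact h.comm_elem j hkj hj
  | succ k ih =>
    have h1 := (h.comm _ _ hkj hj).symm
    exact (h1.mul_right (ih (by omega))).mul_right h1.units_inv_right

lemma commute_barProd_of_lt (h : IsReflectionFamily g ℓ n) {k j : ℕ} (hkj : k < j) (hj : j < n) :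
    Commute (g j : H) (barProd g ℓ k) := by
  induction k with
  | zero => exact h.comm_elem j hkj hj
  | succ k ih => exact (ih (by omega)).mul_right (h.commute_barElem_of_lt hkj hj)

/-- Conjugation by `wordDown g k` turns the commutation of `g (i + 1)` with `ℓ` into this one. -/
lemma commute_barElem_of_gt (h : IsReflectionFamily g ℓ n) {k i : ℕ} (hik : i + 1 < k) (hk : k ≤ n) :
    Commute (g i : H) (barElem g ℓ k) := by
  have h1 := semiconj_barElem g ℓ k
  have h2 := h.semiconj_wordDown hik hk
  have h3 := h.comm_elem (i + 1) (by omega) (by omega)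
  have h4 : (wordDown g k : H) * (g (i + 1) * ℓ) = (wordDown g k : H) * (ℓ * g (i + 1)) := by
    rw [h3.eq]
  rw [(h2.mul_right h1).eq, (h1.mul_right h2).eq] at h4
  exact (Units.mul_left_inj _).1 h4

lemma reflection_barElem (h : IsReflectionFamily g ℓ n) {k : ℕ} (hk : k < n) :
    g k * barElem g ℓ k * g k * barElem g ℓ k = barElem g ℓ k * g k * barElem g ℓ k * g k := by
  induction k with
  | zero => exact h.reflection hk
  | succ k ih =>
    have ih := ih (by omega)
    have hc := (h.commute_barElem_of_lt (Nat.lt_succ_self k) hk).eq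
    have hb := h.braid k hk
    simp only [Nat.succ_eq_add_one] at hc
    rw [barElem]
    generalize barElem g ℓ k = m at *
    generalize g k = a at *
    generalize g (k + 1) = b at *
    -- Braid relations solved for conjugates: `e1` lets `b`, which commutes with `m`, pass so that
    -- the inductive reflection equation for `a` and `m` appears; `e2` leads back afterwards.
    have e1 : (↑a⁻¹ * b * a : H) = b * a * ↑b⁻¹ := by
      rw [Units.eq_mul_inv_iff_mul_eq, mul_assoc, mul_assoc, Units.inv_mul_eq_iff_eq_mul,
        ← mul_assoc, ← mul_assoc, hb]
    have e2 : (↑b⁻¹ * ↑a⁻¹ * b : H) = a * ↑b⁻¹ * ↑a⁻¹ := by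
      rw [Units.eq_mul_inv_iff_mul_eq, Units.eq_mul_inv_iff_mul_eq, mul_assoc, mul_assoc, mul_assoc,
        Units.inv_mul_eq_iff_eq_mul, Units.inv_mul_eq_iff_eq_mul, ← mul_assoc, ← mul_assoc,
        hb]
    have hc' : (↑b⁻¹ * m : H) = m * ↑b⁻¹ := by
      rw [Units.inv_mul_eq_iff_eq_mul, ← mul_assoc, hc, mul_assoc, Units.mul_inv, mul_one]
    calc (b * (a * m * ↑a⁻¹) * b * (a * m * ↑a⁻¹) : H)
        = b * a * m * (↑a⁻¹ * b * a) * m * ↑a⁻¹ := by simp only [mul_assoc]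
      _ = b * a * (m * b) * a * (↑b⁻¹ * m) * ↑a⁻¹ := by rw [e1]; simp only [mul_assoc]
      _ = (b * a * b) * (m * a * m) * ↑b⁻¹ * ↑a⁻¹ := by
        rw [← hc, hc']; simp only [mul_assoc]
      _ = a * b * (a * m * a * m) * ↑b⁻¹ * ↑a⁻¹ := by rw [← hb]; simp only [mul_assoc]
      _ = a * b * m * a * m * (a * ↑b⁻¹ * ↑a⁻¹) := by rw [ih]; simp only [mul_assoc]
      _ = a * (b * m) * a * (m * ↑b⁻¹) * ↑a⁻¹ * b := by rw [← e2]; simp only [mul_assoc]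
      _ = a * m * (b * a * ↑b⁻¹) * m * ↑a⁻¹ * b := by rw [hc, ← hc']; simp only [mul_assoc]
      _ = _ := by rw [← e1]; simp only [mul_assoc]

lemma commute_barElem_mul (h : IsReflectionFamily g ℓ n) {k : ℕ} (hk : k < n) :
    Commute (g k : H) (barElem g ℓ k * barElem g ℓ (k + 1)) := by
  have := h.reflection_barElem hk
  rw [barElem, Commute, SemiconjBy]
  simp only [← mul_assoc]
  rw [this, Units.inv_mul_cancel_right, Units.mul_inv_cancel_right]

/-- The factors numbered `i` and `i + 1` commute with `g i` only as a block, by the reflection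
equation; all other factors commute with it individually. -/
lemma commute_barProd (h : IsReflectionFamily g ℓ n) {k i : ℕ} (hi : i < k) (hk : k ≤ n) :
    Commute (g i : H) (barProd g ℓ k) := by
  induction k with
  | zero => omega
  | succ k ih =>
    rcases Nat.lt_succ_iff_lt_or_eq.1 hi with hi | rfl
    · exact (ih hi (by omega)).mul_right (h.commute_barElem_of_gt (by omega) hk)
    · have h1 := h.commute_barElem_mul (k := i) (by omega)
      rcases i with _ | i
      · exact h1
      · rw [barProd, barProd, mul_assoc]
        exact (h.commute_barProd_of_lt (by omega) (by omega)).mul_right h1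

lemma wordDown_commute_barProd (h : IsReflectionFamily g ℓ n) {k m : ℕ} (hk : k ≤ m) (hm : m ≤ n) :
    Commute (wordDown g k : H) (barProd g ℓ m) := by
  induction k with
  | zero => exact Commute.one_left _
  | succ k ih =>
    rw [wordDown, Units.val_mul]
    exact (h.commute_barProd (by omega) hm).mul_left (ih (by omega))

lemma wordUp_semiconj_elem (h : IsReflectionFamily g ℓ n) {k : ℕ} (hk : k < n) :
    SemiconjBy (wordUp g (k + 1) : H) ℓ (barElem g ℓ 1) := by
  induction k with
  | zero => simp [wordUp, barElem, SemiconjBy, mul_assoc]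
  | succ k ih =>
    rw [wordUp, Units.val_mul]
    exact (ih (by omega)).mul_left (h.comm_elem _ (by omega) hk)

lemma wordUp_semiconj_barElem (h : IsReflectionFamily g ℓ n) {m : ℕ} (hm : m < n) :
    SemiconjBy (wordUp g n : H) (barElem g ℓ m) (barElem g ℓ (m + 1)) := by
  induction m with
  | zero =>
    obtain ⟨k, rfl⟩ : ∃ k, n = k + 1 := ⟨n - 1, by omega⟩
    exact h.wordUp_semiconj_elem (Nat.lt_succ_self k)
  | succ m ih =>
    have h1 := h.semiconj_wordUp (i := m) hm le_rfl
    rw [barElem, barElem]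
    exact (h1.mul_right (ih (by omega))).mul_right h1.units_inv_right

/-- The word raises the index of every factor it passes, and `ℓ` supplies the missing first factor.
-/
lemma elem_mul_wordUp_mul_barProd (h : IsReflectionFamily g ℓ n) {m : ℕ} (hm : m < n) :
    ℓ * (wordUp g n * barProd g ℓ m) = barProd g ℓ (m + 1) * wordUp g n := by
  induction m with
  | zero =>
    rw [barProd, barProd, barProd, mul_assoc, ← (h.wordUp_semiconj_barElem hm).eq]
    rfl
  | succ m ih =>
    rw [barProd, ← mul_assoc, ← mul_assoc, mul_assoc ℓ, ih (by omega), mul_assoc,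
      (h.wordUp_semiconj_barElem hm).eq, barProd.eq_2 g ℓ (m + 1), mul_assoc]

end IsReflectionFamily

/-- Moving `ℓ` through the word yields the missing last factor, and the word commutes with the
completed product. -/
lemma IsReflectionFamily.barProd_mul_wordDown_mul_elem
    (h : IsReflectionFamily g ℓ (n + 1)) :
    barProd g ℓ n * wordDown g (n + 1) * ℓ = wordDown g (n + 1) * barProd g ℓ (n + 1) := by
  rw [mul_assoc, (semiconj_barElem g ℓ (n + 1)).eq, ← mul_assoc, ← barProd,
    (h.wordDown_commute_barProd le_rfl le_rfl).eq]

end ReflectionFamily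

/-! ### Indexing tensor powers by words -/

section Words

variable {ι : Type v} {n : ℕ}

/-- The word `x` followed by the letter `a`. -/
def snocWord (x : Fin n → ι) (a : ι) : Fin (n + 1) → ι := Fin.snoc (α := fun _ => ι) x a

/-- The word `x` preceded by the letter `i`. -/
abbrev consWord (i : ι) (x : Fin n → ι) : Fin (n + 1) → ι := Fin.cons (α := fun _ => ι) i x

@[simp] lemma snocWord_last (x : Fin n → ι) (a : ι) : snocWord x a (Fin.last n) = a := by
  simp [snocWord]

@[simp] lemma snocWord_castSucc (x : Fin n → ι) (a : ι) (c : Fin n) :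
    snocWord x a c.castSucc = x c := by
  simp [snocWord]

lemma snocWord_self (x : Fin (n + 1) → ι) :
    snocWord (fun c => x c.castSucc) (x (Fin.last n)) = x :=
  Fin.snoc_init_self x

lemma snocWord_inj (x y : Fin n → ι) (a b : ι) :
    snocWord x a = snocWord y b ↔ x = y ∧ a = b := by
  refine ⟨fun h => ?_, fun ⟨h1, h2⟩ => by rw [h1, h2]⟩
  exact ⟨by ext c; simpa using congrFun h c.castSucc, by simpa using congrFun h (Fin.last n)⟩

lemma cons_snocWord (i : ι) (x : Fin n → ι) (a : ι) :
    (Fin.cons i (snocWord x a) : Fin (n + 2) → ι) = snocWord (Fin.cons i x) a :=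
  Fin.cons_snoc_eq_snoc_cons (β := ι) i x a

/-- A word is its initial part together with its last letter. -/
def initEquiv (ι : Type v) (n : ℕ) : (Fin (n + 1) → ι) ≃ (Fin n → ι) × ι where
  toFun x := (fun c => x c.castSucc, x (Fin.last n))
  invFun p := snocWord p.1 p.2
  left_inv x := snocWord_self x
  right_inv p := by simp

/-- A word is its tail together with its first letter. -/
def tailEquiv (ι : Type v) (n : ℕ) : (Fin (n + 1) → ι) ≃ (Fin n → ι) × ι where
  toFun x := (fun c => x c.succ, x 0)
  invFun p := Fin.cons p.2 p.1
  left_inv x := Fin.cons_self_tail x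
  right_inv p := by simp

/-- A word is its pair of last letters together with the rest. -/
def lastTwoEquiv (ι : Type v) (n : ℕ) : (Fin (n + 2) → ι) ≃ (ι × ι) × (Fin n → ι) where
  toFun x := ((x (Fin.last n).castSucc, x (Fin.last (n + 1))), fun c => x c.castSucc.castSucc)
  invFun p := snocWord (snocWord p.2 p.1.1) p.1.2
  left_inv x := by
    dsimp only
    rw [show snocWord (fun c : Fin n => x c.castSucc.castSucc) (x (Fin.last n).castSucc) =
      fun c => x c.castSucc from snocWord_self fun c => x c.castSucc]
    exact snocWord_self x
  right_inv p := by simp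

lemma exists_eq_snocWord (x : Fin (n + 1) → ι) : ∃ y i, x = snocWord y i :=
  ⟨_, _, (snocWord_self x).symm⟩

lemma exists_eq_snocWord_snocWord (x : Fin (n + 2) → ι) :
    ∃ y i j, x = snocWord (snocWord y i) j :=
  ⟨_, _, _, ((lastTwoEquiv ι n).left_inv x).symm⟩

end Words

/-! ### Operators acting in some of the tensor copies -/

section Amplify

variable (K : Type u) [CommRing K] {B : Type w} [Ring B] [Algebra K B]
variable {X Y Z : Type*} [Fintype X] [DecidableEq X] [Fintype Y] [DecidableEq Y] [Fintype Z]
  [DecidableEq Z]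

/-- The operator `M ⊗ I` for a decomposition `e` of the space into a tensor product. -/
def amplify (e : X ≃ Y × Z) : Matrix Y Y B →ₐ[K] Matrix X X B :=
  (Matrix.reindexAlgEquiv K B e.symm).toAlgHom.comp
    { Matrix.blockDiagonalRingHom Y Z B |>.comp (Pi.constRingHom Z (Matrix Y Y B)) with
      commutes' := fun r => by
        ext ⟨i, a⟩ ⟨j, b⟩
        by_cases h : a = b <;> by_cases h' : i = j <;>
          simp [Matrix.blockDiagonal_apply, Matrix.algebraMap_matrix_apply, h, h'] }

variable {K}

lemma amplify_apply (e : X ≃ Y × Z) (M : Matrix Y Y B) (x y : X) :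
    amplify K e M x y = if (e x).2 = (e y).2 then M (e x).1 (e y).1 else 0 := by
  simp [amplify, Matrix.blockDiagonal_apply]

lemma amplify_mul_apply (e : X ≃ Y × Z) (M : Matrix Y Y B) (N : Matrix X X B) (a : Y) (r : Z)
    (y : X) : (amplify K e M * N) (e.symm (a, r)) y = ∑ p, M a p * N (e.symm (p, r)) y := by
  rw [Matrix.mul_apply, ← e.symm.sum_comp, Fintype.sum_prod_type]
  simp [amplify_apply, ite_mul]

lemma mul_amplify_apply (e : X ≃ Y × Z) (M : Matrix Y Y B) (N : Matrix X X B) (a : Y) (r : Z)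
    (x : X) : (N * amplify K e M) x (e.symm (a, r)) = ∑ p, N x (e.symm (p, r)) * M p a := by
  rw [Matrix.mul_apply, ← e.symm.sum_comp, Fintype.sum_prod_type]
  simp [amplify_apply, mul_ite]

end Amplify

section Operators

variable {K : Type u} [CommRing K] {ι : Type v} [Fintype ι] [DecidableEq ι]
variable {B : Type w} [Ring B] [Algebra K B] {n : ℕ}

variable (K ι B) in
/-- `Z ↦ Z ⊗ I` as a homomorphism of algebras. -/
def extendHom (n : ℕ) : Matrix (Fin n → ι) (Fin n → ι) B →ₐ[K]
    Matrix (Fin (n + 1) → ι) (Fin (n + 1) → ι) B :=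
  amplify K (initEquiv ι n)

variable (K ι B) in
/-- `Z ↦ I ⊗ Z` as a homomorphism of algebras. -/
def shiftHom (n : ℕ) : Matrix (Fin n → ι) (Fin n → ι) B →ₐ[K]
    Matrix (Fin (n + 1) → ι) (Fin (n + 1) → ι) B :=
  amplify K (tailEquiv ι n)

variable (K ι B) in
/-- `M ↦ I ⊗ M` as a homomorphism of algebras. -/
def lastTwoHom (n : ℕ) : Matrix (ι × ι) (ι × ι) B →ₐ[K]
    Matrix (Fin (n + 2) → ι) (Fin (n + 2) → ι) B :=
  amplify K (lastTwoEquiv ι n)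

lemma extendHom_apply (Z : Matrix (Fin n → ι) (Fin n → ι) B) :
    extendHom K ι B n Z = extend Z := by
  ext x y
  rw [extendHom, amplify_apply]
  rfl

lemma lastTwoHom_apply (M : Matrix (ι × ι) (ι × ι) B) :
    lastTwoHom K ι B n M = lastTwo n M := by
  ext x y
  rw [lastTwoHom, amplify_apply]
  simp [lastTwoEquiv, lastTwo, funext_iff]

lemma shiftHom_apply (Z : Matrix (Fin n → ι) (Fin n → ι) B) (x y : Fin (n + 1) → ι) :
    shiftHom K ι B n Z x y = if x 0 = y 0 then Z (fun c => x c.succ) (fun c => y c.succ) else 0 :=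
  amplify_apply _ _ _ _

lemma shiftHom_extend (Z : Matrix (Fin n → ι) (Fin n → ι) B) :
    shiftHom K ι B (n + 1) (extend Z) = extend (shiftHom K ι B n Z) := by
  ext x y
  simp only [shiftHom_apply, extend, Matrix.of_apply, Fin.succ_last, ← Fin.succ_castSucc,
    Fin.castSucc_zero]
  by_cases h : x 0 = y 0 <;> simp [h]

lemma shiftHom_lastTwo (M : Matrix (ι × ι) (ι × ι) B) :
    shiftHom K ι B (n + 2) (lastTwo n M) = lastTwo (n + 1) M := by
  ext x y
  simp only [shiftHom_apply, lastTwo, Matrix.of_apply, Fin.succ_last, ← Fin.succ_castSucc,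
    Fin.castSucc_zero, Fin.forall_fin_succ (n := n)]
  by_cases h : x 0 = y 0
  · simp only [h, true_and, if_true]
    rfl
  · simp [h]

omit [Fintype ι] in
lemma extend_snocWord (Z : Matrix (Fin n → ι) (Fin n → ι) B) (x y : Fin n → ι) (a b : ι) :
    extend Z (snocWord x a) (snocWord y b) = if a = b then Z x y else 0 := by
  simp [extend]

omit [Fintype ι] in
lemma lastTwo_snocWord (M : Matrix (ι × ι) (ι × ι) B) (x y : Fin n → ι) (i j k l : ι) :
    lastTwo n M (snocWord (snocWord x i) j) (snocWord (snocWord y k) l) =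
      if x = y then M (i, j) (k, l) else 0 := by
  simp [lastTwo, funext_iff]

lemma lastTwo_mul_apply (M : Matrix (ι × ι) (ι × ι) B)
    (N : Matrix (Fin (n + 2) → ι) (Fin (n + 2) → ι) B) (x : Fin n → ι) (i j : ι)
    (y : Fin (n + 2) → ι) :
    (lastTwo n M * N) (snocWord (snocWord x i) j) y =
      ∑ k, ∑ l, M (i, j) (k, l) * N (snocWord (snocWord x k) l) y := by
  rw [← Fintype.sum_prod_type' (f := fun k l => M (i, j) (k, l) * N (snocWord (snocWord x k) l) y),
    ← lastTwoHom_apply (K := ℤ)]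
  exact amplify_mul_apply (lastTwoEquiv ι n) M N (i, j) x y

lemma mul_lastTwo_apply (M : Matrix (ι × ι) (ι × ι) B)
    (N : Matrix (Fin (n + 2) → ι) (Fin (n + 2) → ι) B) (x : Fin n → ι) (i j : ι)
    (y : Fin (n + 2) → ι) :
    (N * lastTwo n M) y (snocWord (snocWord x i) j) =
      ∑ k, ∑ l, N y (snocWord (snocWord x k) l) * M (k, l) (i, j) := by
  rw [← Fintype.sum_prod_type' (f := fun k l => N y (snocWord (snocWord x k) l) * M (k, l) (i, j)),
    ← lastTwoHom_apply (K := ℤ)]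
  exact mul_amplify_apply (lastTwoEquiv ι n) M N (i, j) x y

end Operators

section Scalars

variable {K : Type u} [Field K] {ι : Type v} [Fintype ι] [DecidableEq ι]
variable {B : Type w} [Ring B] [Algebra K B] {n : ℕ}

variable (K B) in
/-- `scalars` as a homomorphism of algebras. -/
def scalarsHom (X : Type*) [Fintype X] [DecidableEq X] : Matrix X X K →ₐ[K] Matrix X X B :=
  (Algebra.ofId K B).mapMatrix

lemma scalarsHom_apply {X : Type*} [Fintype X] [DecidableEq X] (M : Matrix X X K) :
    scalarsHom K B X M = scalars B M := rfl

lemma scalars_apply {X : Type*} (M : Matrix X X K) (x y : X) :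
    scalars B M x y = algebraMap K B (M x y) := rfl

omit [Fintype ι] in
lemma scalars_lastTwo (M : Matrix (ι × ι) (ι × ι) K) :
    scalars B (lastTwo n M) = lastTwo n (scalars B M) := by
  ext x y
  simp only [scalars_apply, lastTwo, Matrix.of_apply]
  split_ifs <;> simp

omit [Fintype ι] in
lemma scalars_extend (Z : Matrix (Fin n → ι) (Fin n → ι) K) :
    scalars B (extend Z) = extend (scalars B Z) := by
  ext x y
  simp only [scalars_apply, extend, Matrix.of_apply]
  split_ifs <;> simp

/-- The operators act in disjoint copies, and the numerical entries are central in `B`. -/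
lemma scalars_lastTwo_commute (M : Matrix (ι × ι) (ι × ι) K)
    (Z : Matrix (Fin n → ι) (Fin n → ι) B) :
    Commute (scalars B (lastTwo n M)) (extend (extend Z)) := by
  rw [scalars_lastTwo, Commute, SemiconjBy]
  ext x y
  obtain ⟨x, i, j, rfl⟩ := exists_eq_snocWord_snocWord x
  obtain ⟨y, k, l, rfl⟩ := exists_eq_snocWord_snocWord y
  simp [lastTwo_mul_apply, mul_lastTwo_apply, extend_snocWord, scalars_apply, Algebra.commutes]

end Scalars

/-! ### Partial `q`-traces, exchange rules and cyclicity -/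

section Trace

variable {K : Type u} [Field K] {ι : Type v} [Fintype ι] [DecidableEq ι]
variable {B : Type w} [Ring B] [Algebra K B] {n : ℕ} (D : Matrix ι ι K)

/-- The `q`-trace over the last copy. -/
def ptrLast (Z : Matrix (Fin (n + 1) → ι) (Fin (n + 1) → ι) B) :
    Matrix (Fin n → ι) (Fin n → ι) B :=
  Matrix.of fun x y => ∑ a, ∑ b, D a b • Z (snocWord x b) (snocWord y a)

omit [DecidableEq ι] in
lemma ptrLast_apply (Z : Matrix (Fin (n + 1) → ι) (Fin (n + 1) → ι) B) (x y : Fin n → ι) :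
    ptrLast D Z x y = ∑ a, ∑ b, D a b • Z (snocWord x b) (snocWord y a) := rfl

omit [DecidableEq ι] in
lemma sum_snocWord {M : Type*} [AddCommMonoid M] (f : (Fin (n + 1) → ι) → M) :
    ∑ x, f x = ∑ x : Fin n → ι, ∑ a, f (snocWord x a) := by
  rw [← (initEquiv ι n).symm.sum_comp, Fintype.sum_prod_type]
  rfl

omit [DecidableEq ι] in
lemma qTrace_ptrLast (Z : Matrix (Fin (n + 1) → ι) (Fin (n + 1) → ι) B) :
    qTrace D (ptrLast D Z) = qTrace D Z := by
  simp only [qTrace, sum_snocWord, ptrLast_apply, Finset.smul_sum, smul_smul,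
    Fin.prod_univ_castSucc, snocWord_last, snocWord_castSucc]
  exact Finset.sum_congr rfl fun x _ => Finset.sum_comm

omit [DecidableEq ι] in
lemma qTraceTail_ptrLast (Z : Matrix (Fin (n + 2) → ι) (Fin (n + 2) → ι) B) :
    qTraceTail D (ptrLast D Z) = qTraceTail D Z := by
  ext i j
  simp only [qTraceTail, Matrix.of_apply, sum_snocWord, ptrLast_apply, Finset.smul_sum, smul_smul,
    Fin.prod_univ_castSucc, snocWord_last, snocWord_castSucc, cons_snocWord]
  exact Finset.sum_congr rfl fun x _ => Finset.sum_comm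

lemma ptrLast_extend_mul (X : Matrix (Fin n → ι) (Fin n → ι) B)
    (Z : Matrix (Fin (n + 1) → ι) (Fin (n + 1) → ι) B) :
    ptrLast D (extend X * Z) = X * ptrLast D Z := by
  ext x y
  simp only [ptrLast_apply, Matrix.mul_apply, sum_snocWord, extend_snocWord, ite_mul, zero_mul,
    Finset.sum_ite_eq, Finset.mem_univ, if_true, Finset.smul_sum, Finset.mul_sum, mul_smul_comm]
  rw [Finset.sum_comm_cycle]

lemma ptrLast_mul_extend (X : Matrix (Fin n → ι) (Fin n → ι) B)
    (Z : Matrix (Fin (n + 1) → ι) (Fin (n + 1) → ι) B) :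
    ptrLast D (Z * extend X) = ptrLast D Z * X := by
  ext x y
  simp only [ptrLast_apply, Matrix.mul_apply, sum_snocWord, extend_snocWord, mul_ite, mul_zero,
    Finset.sum_ite_eq', Finset.mem_univ, if_true, Finset.smul_sum, Finset.sum_mul, smul_mul_assoc]
  rw [Finset.sum_comm_cycle]

/-- All numerical entries gather in one coefficient, which isolates a condition on `D`, `M`, `N`
from the noncommuting entries of `Z`. -/
lemma ptrLast_conj_extend (M N : Matrix (ι × ι) (ι × ι) K)
    (Z : Matrix (Fin (n + 1) → ι) (Fin (n + 1) → ι) B) (x y : Fin n → ι) (i k : ι) :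
    ptrLast D (scalars B (lastTwo n M) * extend Z * scalars B (lastTwo n N))
      (snocWord x i) (snocWord y k) =
    ∑ p, ∑ m, (∑ a, ∑ b, ∑ c, D a b * M (i, b) (m, c) * N (p, c) (k, a)) •
      Z (snocWord x m) (snocWord y p) := by
  have h : ∀ a b, D a b • (scalars B (lastTwo n M) * extend Z * scalars B (lastTwo n N))
      (snocWord (snocWord x i) b) (snocWord (snocWord y k) a) =
      ∑ p, ∑ m, ∑ c, (D a b * M (i, b) (m, c) * N (p, c) (k, a)) •
      Z (snocWord x m) (snocWord y p) := by
    intro a b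
    simp only [scalars_lastTwo, mul_lastTwo_apply, lastTwo_mul_apply, extend_snocWord,
      scalars_apply, mul_ite, mul_zero, Finset.sum_ite_eq', Finset.mem_univ, if_true,
      Finset.sum_mul, Finset.smul_sum]
    refine Finset.sum_congr rfl fun p _ => ?_
    rw [Finset.sum_comm]
    refine Finset.sum_congr rfl fun m _ => Finset.sum_congr rfl fun c _ => ?_
    rw [← Algebra.commutes, Algebra.algebraMap_eq_smul_one, Algebra.algebraMap_eq_smul_one,
      smul_mul_assoc, smul_mul_assoc, one_mul, one_mul, smul_smul, smul_smul]
    congr 1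
    ring
  rw [ptrLast_apply]
  simp only [h, Finset.sum_smul]
  rw [Finset.sum_comm_cycle]
  exact Finset.sum_congr rfl fun p _ => Finset.sum_comm_cycle

variable {D} {R M N : Matrix (ι × ι) (ι × ι) K}

lemma traceSecond_mul_apply (R : Matrix (ι × ι) (ι × ι) K) (Y : Matrix ι ι K) (i k : ι) :
    traceSecond (R * ((1 : Matrix ι ι K) ⊗ₖ Y)) i k = ∑ a, ∑ b, R (i, b) (k, a) * Y a b := by
  rw [Finset.sum_comm]
  simp [traceSecond, Matrix.mul_apply, Fintype.sum_prod_type, Matrix.one_apply, ite_mul]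

lemma IsQTraceMatrix.sum_eq (h : IsQTraceMatrix R D) (i k : ι) :
    ∑ a, ∑ b, R (i, b) (k, a) * D a b = if i = k then 1 else 0 := by
  rw [← traceSecond_mul_apply, h.1, Matrix.one_apply]

/-- Otherwise `D + Y` would be a second solution. This is the form in which the uniqueness of `D` is
used. -/
lemma IsQTraceMatrix.eq_zero (h : IsQTraceMatrix R D) {Y : Matrix ι ι K}
    (hY : ∀ i k, ∑ a, ∑ b, R (i, b) (k, a) * Y a b = 0) : Y = 0 := by
  have := h.2 (D + Y) (by
    ext i k
    rw [traceSecond_mul_apply]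
    simp only [Matrix.add_apply, mul_add, Finset.sum_add_distrib, hY, h.sum_eq, add_zero,
      Matrix.one_apply])
  simpa using this

lemma IsQTraceMatrix.ptrLast_lastTwo (h : IsQTraceMatrix R D) :
    ptrLast D (scalars B (lastTwo n R)) = 1 := by
  ext x y
  obtain ⟨x, i, rfl⟩ := exists_eq_snocWord x
  obtain ⟨y, k, rfl⟩ := exists_eq_snocWord y
  have e := congrArg (algebraMap K B) (h.sum_eq i k)
  simp only [ptrLast_apply, scalars_apply, lastTwo_snocWord, Matrix.one_apply,
    snocWord_inj]
  by_cases hx : x = y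
  · simp only [hx, if_true, true_and, Algebra.smul_def, ← map_mul, ← map_sum]
    simp only [mul_comm (D _ _), e]
    split_ifs <;> simp
  · simp [hx]

/-- The partial `q`-trace over the second copy of `M Z₁ N` is the `q`-trace of `Z`. -/
def IsExchangePair (D : Matrix ι ι K) (M N : Matrix (ι × ι) (ι × ι) K) : Prop :=
  ∀ i k m p, ∑ a, ∑ b, ∑ c, D a b * M (i, b) (m, c) * N (p, c) (k, a) =
    if i = k then D p m else 0

lemma IsExchangePair.ptrLast_conj (h : IsExchangePair D M N)
    (Z : Matrix (Fin (n + 1) → ι) (Fin (n + 1) → ι) B) :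
    ptrLast D (scalars B (lastTwo n M) * extend Z * scalars B (lastTwo n N)) =
      extend (ptrLast D Z) := by
  ext x y
  obtain ⟨x, i, rfl⟩ := exists_eq_snocWord x
  obtain ⟨y, k, rfl⟩ := exists_eq_snocWord y
  rw [ptrLast_conj_extend, extend_snocWord, ptrLast_apply]
  have h' : ∀ m p, _ = _ := h i k
  simp only [h']
  split_ifs <;> simp

/-- For fixed `i`, `k` both sides, as matrices in `p`, `m`, have the same image under the injective
map `Y ↦ Tr₂(R Y₂)`: the braid relation turns the traced conjugate of `R` into `N * 1 * M = 1`. -/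
lemma IsQTraceMatrix.isExchangePair (h : IsQTraceMatrix R D) (hNM : N * M = 1)
    (hYB : lastTwo 1 M * extend (lastTwo 0 R) * lastTwo 1 N =
      extend (lastTwo 0 N) * lastTwo 1 R * extend (lastTwo 0 M)) : IsExchangePair D M N := by
  intro i k
  suffices hz : (Matrix.of fun p m => (∑ a, ∑ b, ∑ c, D a b * M (i, b) (m, c) * N (p, c) (k, a)) -
      if i = k then D p m else 0) = 0 by
    intro m p
    exact sub_eq_zero.1 (congrFun (congrFun hz p) m)
  apply h.eq_zero
  intro s t
  have hs : ∀ (m : ℕ) (Z : Matrix (Fin m → ι) (Fin m → ι) K), scalars K Z = Z := fun m Z => by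
    ext x y; rfl
  -- The trace of `M₂ R₁ N₂` over the third copy in coordinates; the other evaluation comes from
  -- `hYB`.
  have h1 := ptrLast_conj_extend D M N (lastTwo 0 R) (snocWord Fin.elim0 s) (snocWord Fin.elim0 t)
    i k
  have h2 : (lastTwo 0 N * lastTwo 0 M : Matrix (Fin 2 → ι) (Fin 2 → ι) K) = 1 := by
    rw [← lastTwoHom_apply (K := K), ← lastTwoHom_apply (K := K), ← map_mul, hNM, map_one]
  have h3 : ptrLast D (lastTwo 1 R) = 1 := by
    rw [← hs _ (lastTwo 1 R)]; exact h.ptrLast_lastTwo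
  simp only [hs] at h1
  rw [hYB, ptrLast_mul_extend, ptrLast_extend_mul, h3, mul_one, h2] at h1
  simp only [lastTwo_snocWord, Matrix.one_apply, snocWord_inj, true_and, if_true,
    smul_eq_mul] at h1
  simp only [Matrix.of_apply, mul_sub, Finset.sum_sub_distrib]
  rw [sub_eq_zero]
  simp only [mul_comm (R _ _)]
  rw [← h1]
  have h4 := h.sum_eq s t
  by_cases hik : i = k
  · simp only [hik, if_true, and_true, mul_comm (D _ _), h4]
  · simp [hik]

/-- The square of `D` commutes with `N`. -/
lemma IsQTraceMatrix.kronecker_commute (h : IsQTraceMatrix R D) (h1 : IsExchangePair D R N)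
    (h2 : IsExchangePair D N R) : Commute (D ⊗ₖ D) N := by
  -- With the first-copy indices `u`, `v` fixed, the two products are compared through the injective
  -- map `Y ↦ Tr₂(R Y₂)`; `e1` needs the pair `(N, R)` and `e2` the pair `(R, N)`.
  have e1 : ∀ u v i k, ∑ a, ∑ b, R (i, b) (k, a) * ((D ⊗ₖ D) * N) (u, a) (v, b) =
      D u k * D i v := by
    intro u v i k
    calc _ = ∑ s, D u s * ∑ a, ∑ b, ∑ c, D a b * N (s, b) (v, c) * R (i, c) (k, a) := by
          simp only [Matrix.mul_apply, Matrix.kronecker_apply, Fintype.sum_prod_type,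
            Finset.mul_sum]
          rw [Finset.sum_comm_cycle]
          refine Finset.sum_congr rfl fun s _ => Finset.sum_congr rfl fun a _ => ?_
          rw [Finset.sum_comm]
          refine Finset.sum_congr rfl fun b _ => Finset.sum_congr rfl fun c _ => ?_
          ring
      _ = _ := by
          have h' : ∀ s, _ = _ := fun s => h2 s k v i
          simp [h']
  have e2 : ∀ u v i k, ∑ a, ∑ b, R (i, b) (k, a) * (N * (D ⊗ₖ D)) (u, a) (v, b) =
      D u k * D i v := by
    intro u v i k
    calc _ = ∑ t, (∑ a, ∑ b, ∑ c, D a b * R (i, b) (k, c) * N (u, c) (t, a)) * D t v := by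
          simp only [Matrix.mul_apply, Matrix.kronecker_apply, Fintype.sum_prod_type,
            Finset.mul_sum, Finset.sum_mul]
          rw [Finset.sum_comm_cycle]
          refine Finset.sum_congr rfl fun t _ => ?_
          rw [Finset.sum_comm_cycle]
          refine Finset.sum_congr rfl fun a _ => ?_
          rw [Finset.sum_comm]
          refine Finset.sum_congr rfl fun b _ => Finset.sum_congr rfl fun c _ => ?_
          ring
      _ = _ := by
          have h' : ∀ t, _ = _ := fun t => h1 i t k u
          simp [h', mul_comm]
  ext ⟨u, a⟩ ⟨v, b⟩
  have hz : (Matrix.of fun a b => ((D ⊗ₖ D) * N) (u, a) (v, b) - (N * (D ⊗ₖ D)) (u, a) (v, b)) =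
      0 := by
    apply h.eq_zero
    intro i k
    simp only [Matrix.of_apply, mul_sub, Finset.sum_sub_distrib, e1, e2, sub_self]
  exact sub_eq_zero.1 (congrFun (congrFun hz a) b)

variable (D)

omit [DecidableEq ι] in
lemma ptrLast_ptrLast_apply (Z : Matrix (Fin (n + 2) → ι) (Fin (n + 2) → ι) B)
    (x y : Fin n → ι) :
    ptrLast D (ptrLast D Z) x y = ∑ p : ι × ι, ∑ r : ι × ι, (D ⊗ₖ D) p r •
      Z (snocWord (snocWord x r.1) r.2) (snocWord (snocWord y p.1) p.2) := by
  simp only [ptrLast_apply, Fintype.sum_prod_type, Matrix.kronecker_apply, mul_smul,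
    Finset.smul_sum]
  exact Finset.sum_congr rfl fun a _ => Finset.sum_comm

variable {D}

lemma ptrLast_ptrLast_mul_comm (hM : Commute (D ⊗ₖ D) M)
    (Z : Matrix (Fin (n + 2) → ι) (Fin (n + 2) → ι) B) :
    ptrLast D (ptrLast D (scalars B (lastTwo n M) * Z)) =
      ptrLast D (ptrLast D (Z * scalars B (lastTwo n M))) := by
  ext x y
  have h1 : ∀ (r : ι × ι) y, (scalars B (lastTwo n M) * Z) (snocWord (snocWord x r.1) r.2) y =
      ∑ t : ι × ι, M r t • Z (snocWord (snocWord x t.1) t.2) y := by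
    intro r y
    simp only [scalars_lastTwo, lastTwo_mul_apply, scalars_apply, Fintype.sum_prod_type,
      ← Algebra.smul_def]
  have h2 : ∀ (r : ι × ι) x, (Z * scalars B (lastTwo n M)) x (snocWord (snocWord y r.1) r.2) =
      ∑ t : ι × ι, M t r • Z x (snocWord (snocWord y t.1) t.2) := by
    intro r x
    simp only [scalars_lastTwo, mul_lastTwo_apply, scalars_apply, Fintype.sum_prod_type,
      ← Algebra.commutes, ← Algebra.smul_def]
  trans ∑ p : ι × ι, ∑ r : ι × ι, ((D ⊗ₖ D) * M) p r •
      Z (snocWord (snocWord x r.1) r.2) (snocWord (snocWord y p.1) p.2)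
  · simp only [ptrLast_ptrLast_apply, h1, Matrix.mul_apply, Finset.sum_smul, Finset.smul_sum,
      smul_smul]
    exact Finset.sum_congr rfl fun p _ => Finset.sum_comm
  · rw [hM.eq]
    simp only [ptrLast_ptrLast_apply, h2, Matrix.mul_apply, Finset.sum_smul, Finset.smul_sum,
      smul_smul]
    symm
    rw [Finset.sum_comm_cycle]
    refine Finset.sum_congr rfl fun p _ => ?_
    rw [Finset.sum_comm]
    simp only [mul_comm]

variable (D)

omit [DecidableEq ι] in
lemma qTrace_add (Y Z : Matrix (Fin n → ι) (Fin n → ι) B) :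
    qTrace D (Y + Z) = qTrace D Y + qTrace D Z := by
  simp only [qTrace, Matrix.add_apply, smul_add, Finset.sum_add_distrib]

omit [DecidableEq ι] in
lemma qTraceTail_smul (c : K) (Z : Matrix (Fin (n + 1) → ι) (Fin (n + 1) → ι) B) :
    qTraceTail D (c • Z) = c • qTraceTail D Z := by
  ext i j
  simp only [qTraceTail, Matrix.of_apply, Matrix.smul_apply, smul_comm _ c, Finset.smul_sum]

omit [DecidableEq ι] in
lemma qTraceTail_sub (Y Z : Matrix (Fin (n + 1) → ι) (Fin (n + 1) → ι) B) :
    qTraceTail D (Y - Z) = qTraceTail D Y - qTraceTail D Z := by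
  ext i j
  simp only [qTraceTail, Matrix.of_apply, Matrix.sub_apply, smul_sub, Finset.sum_sub_distrib]

variable (B n) in
/-- The operators that can be moved cyclically under the `q`-trace. -/
def qCyclic : Subalgebra K (Matrix (Fin n → ι) (Fin n → ι) B) where
  carrier := {W | ∀ Z, qTrace D (W * Z) = qTrace D (Z * W)}
  mul_mem' {X Y} hX hY Z := by rw [mul_assoc, hX, mul_assoc, hY, mul_assoc]
  add_mem' {X Y} hX hY Z := by rw [add_mul, mul_add, qTrace_add, qTrace_add, hX, hY]
  algebraMap_mem' r Z := by rw [Algebra.commutes]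

variable {D}

lemma inv_mem_qCyclic {W : (Matrix (Fin n → ι) (Fin n → ι) B)ˣ} (h : ↑W ∈ qCyclic B n D) :
    ↑W⁻¹ ∈ qCyclic B n D := by
  intro Z
  have := h (W⁻¹.val * Z * W⁻¹.val)
  rw [mul_assoc, mul_assoc, Units.mul_inv_cancel_left, mul_assoc, Units.inv_mul, mul_one] at this
  exact this.symm

lemma extend_mem_qCyclic {W : Matrix (Fin n → ι) (Fin n → ι) B} (h : W ∈ qCyclic B n D) :
    extend W ∈ qCyclic B (n + 1) D := by
  intro Z
  rw [← qTrace_ptrLast, ptrLast_extend_mul, h, ← ptrLast_mul_extend, qTrace_ptrLast]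

lemma lastTwo_mem_qCyclic (hM : Commute (D ⊗ₖ D) M) :
    scalars B (lastTwo n M) ∈ qCyclic B (n + 2) D := by
  intro Z
  rw [← qTrace_ptrLast, ← qTrace_ptrLast, ptrLast_ptrLast_mul_comm hM, qTrace_ptrLast,
    qTrace_ptrLast]

omit [DecidableEq ι] in
lemma qTraceTail_apply (Z : Matrix (Fin (n + 1) → ι) (Fin (n + 1) → ι) B) (i j : ι) :
    qTraceTail D Z i j = qTrace D (Z.submatrix (consWord i) (consWord j)) := rfl

lemma shiftHom_mul_submatrix (W : Matrix (Fin n → ι) (Fin n → ι) B)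
    (Z : Matrix (Fin (n + 1) → ι) (Fin (n + 1) → ι) B) (i j : ι) :
    (shiftHom K ι B n W * Z).submatrix (consWord i) (consWord j) =
      W * Z.submatrix (consWord i) (consWord j) := by
  ext x y
  exact amplify_mul_apply (tailEquiv ι n) W Z x i (consWord j y)

lemma mul_shiftHom_submatrix (W : Matrix (Fin n → ι) (Fin n → ι) B)
    (Z : Matrix (Fin (n + 1) → ι) (Fin (n + 1) → ι) B) (i j : ι) :
    (Z * shiftHom K ι B n W).submatrix (consWord i) (consWord j) =
      Z.submatrix (consWord i) (consWord j) * W := by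
  ext x y
  exact mul_amplify_apply (tailEquiv ι n) W Z y j (consWord i x)

/-- For fixed first-copy indices this is cyclicity of the full trace over the remaining copies. -/
lemma qTraceTail_mul_comm {W : Matrix (Fin n → ι) (Fin n → ι) B} (hW : W ∈ qCyclic B n D)
    (Z : Matrix (Fin (n + 1) → ι) (Fin (n + 1) → ι) B) :
    qTraceTail D (shiftHom K ι B n W * Z) = qTraceTail D (Z * shiftHom K ι B n W) := by
  ext i j
  rw [qTraceTail_apply, qTraceTail_apply, shiftHom_mul_submatrix, mul_shiftHom_submatrix, hW]

end Trace

/-! ### The matrix `L` in the first copy -/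

section FirstCopy

variable {K : Type u} [Field K] {ι : Type v} [Fintype ι] [DecidableEq ι]
variable {B : Type w} [Ring B] [Algebra K B]

variable (K ι B) in
/-- `L ↦ L ⊗ I` with values in the operators on `V^{⊗ (n+1)}`. -/
def firstHom (n : ℕ) : Matrix ι ι B →ₐ[K] Matrix (Fin (n + 1) → ι) (Fin (n + 1) → ι) B :=
  amplify K ((tailEquiv ι n).trans (Equiv.prodComm _ _))

variable {n : ℕ}

lemma firstHom_apply (L : Matrix ι ι B) (x y : Fin (n + 1) → ι) :
    firstHom K ι B n L x y =
      if (fun c : Fin n => x c.succ) = (fun c => y c.succ) then L (x 0) (y 0) else 0 :=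
  amplify_apply _ _ _ _

lemma extend_firstHom (L : Matrix ι ι B) :
    extend (firstHom K ι B n L) = firstHom K ι B (n + 1) L := by
  ext x y
  simp only [extend, Matrix.of_apply, firstHom_apply, funext_iff, Fin.forall_fin_succ' (n := n),
    Fin.succ_last, Fin.succ_castSucc, Fin.castSucc_zero]
  by_cases h : x (Fin.last (n + 1)) = y (Fin.last (n + 1)) <;> simp [h]

lemma firstHom_zero (R : Matrix (ι × ι) (ι × ι) K) (L : Matrix ι ι B) :
    firstHom K ι B 0 L = Lbar R L 0 := by
  ext x y
  simp [firstHom_apply, Lbar, funext_iff]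

lemma firstHom_one (L : Matrix ι ι B) :
    firstHom K ι B 1 L = lastTwoHom K ι B 0 (L ⊗ₖ (1 : Matrix ι ι B)) := by
  ext x y
  simp [firstHom_apply, lastTwoHom_apply, lastTwo, funext_iff, Matrix.one_apply]

lemma qTraceTail_firstHom_mul (D : Matrix ι ι K) (L : Matrix ι ι B)
    (Z : Matrix (Fin (n + 1) → ι) (Fin (n + 1) → ι) B) :
    qTraceTail D (firstHom K ι B n L * Z) = L * qTraceTail D Z := by
  ext i j
  have h : ∀ y w, (firstHom K ι B n L * Z) (Fin.cons i y) w = ∑ k, L i k * Z (Fin.cons k y) w :=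
    fun y w => amplify_mul_apply ((tailEquiv ι n).trans (Equiv.prodComm _ _)) L Z i y w
  simp only [qTraceTail, Matrix.of_apply, Matrix.mul_apply (M := L), h, Finset.smul_sum,
    Finset.mul_sum, mul_smul_comm]
  rw [Finset.sum_comm_cycle]

lemma qTraceTail_mul_firstHom (D : Matrix ι ι K) (L : Matrix ι ι B)
    (Z : Matrix (Fin (n + 1) → ι) (Fin (n + 1) → ι) B) :
    qTraceTail D (Z * firstHom K ι B n L) = qTraceTail D Z * L := by
  ext i j
  have h : ∀ y w, (Z * firstHom K ι B n L) w (Fin.cons j y) = ∑ k, Z w (Fin.cons k y) * L k j :=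
    fun y w => mul_amplify_apply ((tailEquiv ι n).trans (Equiv.prodComm _ _)) L Z j y w
  simp only [qTraceTail, Matrix.of_apply, Matrix.mul_apply (N := L), h, Finset.smul_sum,
    Finset.sum_mul, smul_mul_assoc]
  rw [Finset.sum_comm_cycle]

end FirstCopy

/-! ### The braid generators on tensor powers -/

section Generators

variable {K : Type u} [Field K] {ι : Type v} [Fintype ι] [DecidableEq ι]

lemma IsHecke.mul_self {q : K} (hq0 : q ≠ 0) {R : Matrix (ι × ι) (ι × ι) K} (h : IsHecke q R) :
    R * R = (q - q⁻¹) • R + 1 := by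
  obtain ⟨S, A, hS, hA, hSA, hAS, h1, rfl⟩ := h
  rw [← h1]
  simp only [sub_mul, mul_sub, smul_mul_assoc, mul_smul_comm, hS, hA, hSA, hAS, smul_zero,
    smul_sub, smul_smul, sub_smul, inv_mul_cancel₀ hq0, mul_inv_cancel₀ hq0, one_smul]
  abel

/-- A matrix of Hecke type as a unit. -/
def heckeUnit {q : K} (hq0 : q ≠ 0) {R : Matrix (ι × ι) (ι × ι) K} (h : IsHecke q R) :
    (Matrix (ι × ι) (ι × ι) K)ˣ where
  val := R
  inv := R - (q - q⁻¹) • 1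
  val_inv := by rw [mul_sub, h.mul_self hq0, mul_smul_comm, mul_one, add_sub_cancel_left]
  inv_val := by rw [sub_mul, h.mul_self hq0, smul_mul_assoc, one_mul, add_sub_cancel_left]

variable (B : Type w) [Ring B] [Algebra K B] (ρ : (Matrix (ι × ι) (ι × ι) K)ˣ)

/-- The operators `R̂_{i+1}` on `V^{⊗ (n+1)}` for `i < n`. -/
def genUnit : (n : ℕ) → ℕ → (Matrix (Fin (n + 1) → ι) (Fin (n + 1) → ι) B)ˣ
  -- A default value: one copy carries no generator, and every index `i ≥ n` ends here too.
  | 0, _ => 1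
  | n + 1, i =>
    if i = n then
      Units.map (MonoidHomClass.toMonoidHom (scalarsHom K B (Fin (n + 2) → ι)))
        (Units.map (MonoidHomClass.toMonoidHom (lastTwoHom K ι K n)) ρ)
    else Units.map (MonoidHomClass.toMonoidHom (extendHom K ι B (n + 1))) (genUnit n i)

variable {B} {ρ} {n i : ℕ}

variable (n) in
lemma val_genUnit_last :
    (genUnit B ρ (n + 1) n : Matrix (Fin (n + 2) → ι) (Fin (n + 2) → ι) B) =
      scalars B (lastTwo n ρ.val) := by
  simp [genUnit, scalarsHom_apply, lastTwoHom_apply]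

variable (n) in
lemma val_genUnit_last_inv :
    ((genUnit B ρ (n + 1) n)⁻¹.val : Matrix (Fin (n + 2) → ι) (Fin (n + 2) → ι) B) =
      scalars B (lastTwo n ρ⁻¹.val) := by
  simp [genUnit, ← map_inv, scalarsHom_apply, lastTwoHom_apply]

lemma genUnit_of_lt (hi : i < n) :
    genUnit B ρ (n + 1) i = Units.map (MonoidHomClass.toMonoidHom (extendHom K ι B (n + 1))) (genUnit B ρ n i) := by
  rw [genUnit, if_neg hi.ne]

lemma val_genUnit_of_lt (hi : i < n) :
    (genUnit B ρ (n + 1) i : Matrix (Fin (n + 2) → ι) (Fin (n + 2) → ι) B) =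
      extend (genUnit B ρ n i).val := by
  rw [genUnit_of_lt hi, Units.coe_map, ← extendHom_apply (K := K)]
  rfl

lemma genUnit_shift (hi : i < n) :
    genUnit B ρ (n + 1) (i + 1) =
      Units.map (MonoidHomClass.toMonoidHom (shiftHom K ι B (n + 1))) (genUnit B ρ n i) := by
  induction n with
  | zero => omega
  | succ n ih =>
    apply Units.ext
    change _ = shiftHom K ι B (n + 2) (genUnit B ρ (n + 1) i).val
    rcases Nat.lt_succ_iff_lt_or_eq.1 hi with hi | rfl
    · rw [val_genUnit_of_lt hi, shiftHom_extend, val_genUnit_of_lt (by omega), ih hi]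
      rfl
    · rw [val_genUnit_last, val_genUnit_last, scalars_lastTwo, scalars_lastTwo, shiftHom_lastTwo]

lemma braid_lastTwo {R : Matrix (ι × ι) (ι × ι) K} (h : IsYangBaxter R) (n : ℕ) :
    extend (lastTwo n R) * lastTwo (n + 1) R * extend (lastTwo n R) =
      lastTwo (n + 1) R * extend (lastTwo n R) * lastTwo (n + 1) R := by
  induction n with
  | zero => exact h
  | succ n ih =>
    have := congrArg (shiftHom K ι K (n + 3)) ih
    simpa only [map_mul, shiftHom_extend, shiftHom_lastTwo] using this

lemma extend_mul (X Y : Matrix (Fin n → ι) (Fin n → ι) B) :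
    extend (X * Y) = extend X * extend Y := by
  simp only [← extendHom_apply (K := ℤ), map_mul]

lemma scalars_mul {X : Type*} [Fintype X] [DecidableEq X] (M N : Matrix X X K) :
    scalars B (M * N) = scalars B M * scalars B N := by
  simp only [← scalarsHom_apply, map_mul]

lemma isHeckeFamily_genUnit {q : K} (hYB : IsYangBaxter ρ.val)
    (hq : ρ.val * ρ.val = (q - q⁻¹) • ρ.val + 1) (n : ℕ) :
    IsHeckeFamily q (fun i => (genUnit B ρ n i).val) n := by
  induction n with
  | zero => exact ⟨by intros; omega, by intros; omega, by intros; omega⟩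
  | succ n ih =>
    refine ⟨fun i hi => ?_, fun i hi => ?_, fun i j hij hj => ?_⟩
    · rcases Nat.lt_succ_iff_lt_or_eq.1 hi with hi | rfl
      · have := congrArg (extendHom K ι B (n + 1)) (ih.quad i hi)
        simpa only [map_mul, map_add, map_smul, map_one, extendHom_apply,
          ← val_genUnit_of_lt hi] using this
      · have := congrArg (fun M => scalarsHom K B _ (lastTwoHom K ι K i M)) hq
        simpa only [map_mul, map_add, map_smul, map_one, lastTwoHom_apply, scalarsHom_apply,
          ← val_genUnit_last] using this
    · rcases Nat.lt_succ_iff_lt_or_eq.1 hi with hi | rfl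
      · have := congrArg (extendHom K ι B (n + 1)) (ih.braid i hi)
        simpa only [map_mul, extendHom_apply, ← val_genUnit_of_lt hi,
          ← val_genUnit_of_lt (Nat.lt_of_succ_lt hi)] using this
      · rw [val_genUnit_last, val_genUnit_of_lt (Nat.lt_succ_self i), val_genUnit_last,
          ← scalars_extend, ← scalars_mul, ← scalars_mul, ← scalars_mul, ← scalars_mul,
          braid_lastTwo hYB]
    · rcases Nat.lt_succ_iff_lt_or_eq.1 hj with hj | rfl
      · have := congrArg (extendHom K ι B (n + 1)) (ih.comm i j hij hj)
        simpa only [map_mul, extendHom_apply, ← val_genUnit_of_lt hj,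
          ← val_genUnit_of_lt (show i < n by omega)] using this
      · obtain ⟨m, rfl⟩ : ∃ m, j = m + 1 := ⟨j - 1, by omega⟩
        rw [val_genUnit_last, val_genUnit_of_lt (show i < m + 1 by omega),
          val_genUnit_of_lt (show i < m by omega)]
        exact (scalars_lastTwo_commute _ _).symm.eq

lemma isReflectionFamily_genUnit {q : K} (hYB : IsYangBaxter ρ.val)
    (hq : ρ.val * ρ.val = (q - q⁻¹) • ρ.val + 1) {L : Matrix ι ι B}
    (hL : rlrlLeft ρ.val L = rlrlRight ρ.val L) (n : ℕ) :
    IsReflectionFamily (genUnit B ρ n) (firstHom K ι B n L) n where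
  braid := (isHeckeFamily_genUnit hYB hq n).braid
  comm := (isHeckeFamily_genUnit hYB hq n).comm
  comm_elem i h0 hi := by
    induction n with
    | zero => omega
    | succ n ih =>
      rw [← extend_firstHom]
      rcases Nat.lt_succ_iff_lt_or_eq.1 hi with hi | rfl
      · rw [val_genUnit_of_lt hi, Commute, SemiconjBy, ← extend_mul, (ih hi).eq, extend_mul]
      · obtain ⟨m, rfl⟩ : ∃ m, i = m + 1 := ⟨i - 1, by omega⟩
        rw [← extend_firstHom, val_genUnit_last]
        exact scalars_lastTwo_commute _ _
  reflection h0 := by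
    obtain ⟨n, rfl⟩ : ∃ m, n = m + 1 := ⟨n - 1, by omega⟩
    clear h0
    induction n with
    | zero =>
      rw [firstHom_one, val_genUnit_last, scalars_lastTwo, ← lastTwoHom_apply (K := K),
        ← map_mul, ← map_mul, ← map_mul, ← map_mul, ← map_mul, ← map_mul]
      exact congrArg _ hL
    | succ n ih =>
      rw [← extend_firstHom, val_genUnit_of_lt (Nat.succ_pos n)]
      simp only [← extend_mul, ih]

end Generators

/-! ### Words, antisymmetrizers and the element `ℓ` -/

section WordActions

variable {K : Type*} [Field K] {H : Type*} [Ring H] [Algebra K H] {q : K} {g : ℕ → Hˣ} {ℓ : H}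
  {n : ℕ}

lemma wordUp_mul_of_absorb {c : K} {x : H} (h : ∀ i < n, g i * x = c • x) :
    (wordUp g n : H) * x = c ^ n • x := by
  induction n with
  | zero => simp [wordUp]
  | succ n ih =>
    rw [wordUp, Units.val_mul, mul_assoc, h n (by omega), mul_smul_comm,
      ih fun i hi => h i (by omega), smul_smul, pow_succ']

namespace IsReflectionFamily

lemma elem_commute_antisym (h : IsReflectionFamily g ℓ (n + 1)) :
    Commute ℓ (antisym q (fun i => (g (i + 1)).val) n) :=
  antisym_commute fun i hi => (h.comm_elem (i + 1) (by omega) (by omega)).symm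

lemma wordUp_semiconj_antisym (h : IsReflectionFamily g ℓ (n + 1)) :
    SemiconjBy (wordUp g (n + 1)).val (antisym q (fun i => (g i).val) n)
      (antisym q (fun i => (g (i + 1)).val) n) :=
  antisym_semiconj fun _ hi => h.semiconj_wordUp (by omega) le_rfl

/-- The right side is also that of `conj_wordDown_mul_elem`, where `ℓ` stands on the other side of a
conjugate; under the trace this coincidence becomes centrality. -/
lemma elem_mul_conj_wordUp (h : IsReflectionFamily g ℓ (n + 1)) :
    ℓ * ((wordUp g (n + 1)).val * (antisym q (fun i => (g i).val) n * barProd g ℓ n) *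
      (wordUp g (n + 1))⁻¹.val) =
    antisym q (fun i => (g (i + 1)).val) n * barProd g ℓ (n + 1) := by
  rw [← mul_assoc, Units.mul_inv_eq_iff_eq_mul, ← mul_assoc (wordUp g (n + 1)).val,
    (h.wordUp_semiconj_antisym (q := q)).eq, mul_assoc, ← mul_assoc ℓ,
    (h.elem_commute_antisym (q := q)).eq, mul_assoc, h.elem_mul_wordUp_mul_barProd
    (Nat.lt_succ_self n), mul_assoc]

lemma conj_wordDown_mul_elem (h : IsReflectionFamily g ℓ (n + 1)) :
    (wordDown g (n + 1))⁻¹.val * (antisym q (fun i => (g i).val) n * barProd g ℓ n) *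
      (wordDown g (n + 1)).val * ℓ =
    antisym q (fun i => (g (i + 1)).val) n * barProd g ℓ (n + 1) := by
  have h1 : SemiconjBy (wordDown g (n + 1)).val (antisym q (fun i => (g (i + 1)).val) n)
      (antisym q (fun i => (g i).val) n) :=
    antisym_semiconj fun _ hi => h.semiconj_wordDown (by omega) le_rfl
  rw [mul_assoc, mul_assoc, Units.inv_mul_eq_iff_eq_mul, mul_assoc, ← mul_assoc (barProd g ℓ n),
    h.barProd_mul_wordDown_mul_elem, ← mul_assoc, ← h1.eq, mul_assoc]

/-- After `g 0` commutes past the product `ℓ U P U⁻¹`, it cancels the first letter of `U` inside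
`U⁻¹`. -/
lemma antisym_mul_first_mul_barProd (h : IsReflectionFamily g ℓ (n + 1)) :
    antisym q (fun i => (g (i + 1)).val) n * g 0 * barProd g ℓ (n + 1) =
      antisym q (fun i => (g (i + 1)).val) n *
        (ℓ * ((wordUp g (n + 1)).val * barProd g ℓ n)) *
        (wordUp (fun i => g (i + 1)) n)⁻¹.val := by
  rw [h.elem_mul_wordUp_mul_barProd (Nat.lt_succ_self n), wordUp_succ', mul_assoc, mul_assoc,
    (h.commute_barProd (Nat.succ_pos n) le_rfl).eq, Units.val_mul, mul_assoc, mul_assoc,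
    Units.mul_inv, mul_one]

end IsReflectionFamily

end WordActions

/-! ### Concrete matrices as instances of the abstract elements -/

section Identification

variable {K : Type u} [Field K] {ι : Type v} [Fintype ι] [DecidableEq ι]
variable {B : Type w} [Ring B] [Algebra K B] {ρ : (Matrix (ι × ι) (ι × ι) K)ˣ} {n : ℕ}

lemma extend_antisym (q : K) {k : ℕ} (hk : k ≤ n) :
    extend (antisym q (fun i => (genUnit B ρ n i).val) k) =
      antisym q (fun i => (genUnit B ρ (n + 1) i).val) k := by
  rw [← extendHom_apply (K := K), map_antisym]
  exact antisym_congr q fun i hi => by rw [val_genUnit_of_lt (by omega), extendHom_apply]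

lemma shiftHom_antisym (q : K) :
    shiftHom K ι B (n + 1) (antisym q (fun i => (genUnit B ρ n i).val) n) =
      antisym q (fun i => (genUnit B ρ (n + 1) (i + 1)).val) n := by
  rw [map_antisym]
  exact antisym_congr q fun i hi => by rw [genUnit_shift hi]; rfl

lemma scalars_antisymmetrizer (q : K) (n : ℕ) :
    scalars B (antisymmetrizer q ρ.val n) = antisym q (fun i => (genUnit B ρ n i).val) n := by
  induction n with
  | zero => exact map_one (scalarsHom K B _)
  | succ n ih =>
    rw [antisym, ← extend_antisym q le_rfl, ← ih, val_genUnit_last, ← scalars_extend,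
      antisymmetrizer]
    simp only [← scalarsHom_apply, map_smul, map_mul, map_sub, map_one]

lemma extend_barProd (L : Matrix ι ι B) {k : ℕ} (hk : k ≤ n) :
    extend (barProd (genUnit B ρ n) (firstHom K ι B n L) k) =
      barProd (genUnit B ρ (n + 1)) (firstHom K ι B (n + 1) L) k := by
  have := map_barProd (g := genUnit B ρ n) (ℓ := firstHom K ι B n L)
    (MonoidHomClass.toMonoidHom (extendHom K ι B (n + 1))) k
  rw [← extend_firstHom, ← extendHom_apply (K := K), ← extendHom_apply (K := K)]
  exact this.trans (barProd_congr fun i hi => (genUnit_of_lt (by omega)).symm)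

lemma extend_barElem (L : Matrix ι ι B) {k : ℕ} (hk : k ≤ n) :
    extend (barElem (genUnit B ρ n) (firstHom K ι B n L) k) =
      barElem (genUnit B ρ (n + 1)) (firstHom K ι B (n + 1) L) k := by
  have := map_barElem (g := genUnit B ρ n) (ℓ := firstHom K ι B n L)
    (MonoidHomClass.toMonoidHom (extendHom K ι B (n + 1))) k
  rw [← extend_firstHom, ← extendHom_apply (K := K), ← extendHom_apply (K := K)]
  exact this.trans (barElem_congr fun i hi => (genUnit_of_lt (by omega)).symm)

lemma Lbar_eq_barElem (L : Matrix ι ι B) (n : ℕ) :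
    Lbar ρ.val L n = barElem (genUnit B ρ n) (firstHom K ι B n L) n := by
  induction n with
  | zero => exact (firstHom_zero ρ.val L).symm
  | succ n ih =>
    rw [Lbar, barElem, ih, extend_barElem L le_rfl, val_genUnit_last, val_genUnit_last_inv,
      Matrix.coe_units_inv]

lemma LbarProd_eq_barProd (L : Matrix ι ι B) (n : ℕ) :
    LbarProd ρ.val L n = barProd (genUnit B ρ n) (firstHom K ι B n L) n := by
  induction n with
  | zero => exact (firstHom_zero ρ.val L).symm
  | succ n ih => rw [LbarProd, barProd, ih, extend_barProd L le_rfl, Lbar_eq_barElem]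

variable (n) in
/-- `extend` on units. -/
def extendUnit (u : (Matrix (Fin n → ι) (Fin n → ι) B)ˣ) :
    (Matrix (Fin (n + 1) → ι) (Fin (n + 1) → ι) B)ˣ :=
  Units.map (MonoidHomClass.toMonoidHom (extendHom ℤ ι B n)) u

lemma val_extendUnit (u : (Matrix (Fin n → ι) (Fin n → ι) B)ˣ) :
    (extendUnit n u).val = extend u.val :=
  extendHom_apply (K := ℤ) u.val

lemma val_extendUnit_inv (u : (Matrix (Fin n → ι) (Fin n → ι) B)ˣ) :
    (extendUnit n u)⁻¹.val = extend u⁻¹.val :=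
  extendHom_apply (K := ℤ) u⁻¹.val

lemma genUnit_eq_extendUnit {i : ℕ} (hi : i < n) :
    genUnit B ρ (n + 1) i = extendUnit (n + 1) (genUnit B ρ n i) :=
  Units.ext (by rw [val_genUnit_of_lt hi, val_extendUnit])

lemma wordUp_genUnit_succ {k : ℕ} (hk : k ≤ n) :
    wordUp (genUnit B ρ (n + 1)) k = extendUnit (n + 1) (wordUp (genUnit B ρ n) k) :=
  (wordUp_congr fun _ hi => genUnit_eq_extendUnit (by omega)).trans (map_wordUp _ k).symm

lemma wordDown_genUnit_succ {k : ℕ} (hk : k ≤ n) :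
    wordDown (genUnit B ρ (n + 1)) k = extendUnit (n + 1) (wordDown (genUnit B ρ n) k) :=
  (wordDown_congr fun _ hi => genUnit_eq_extendUnit (by omega)).trans (map_wordDown _ k).symm

end Identification

/-! ### Centrality, the recursion and the Cayley–Hamilton–Newton identity -/

section Main

variable {K : Type u} [Field K] {ι : Type v} [Fintype ι] [DecidableEq ι]
variable {B : Type w} [Ring B] [Algebra K B] {ρ : (Matrix (ι × ι) (ι × ι) K)ˣ} {D : Matrix ι ι K}
  {n : ℕ} {q : K} {L : Matrix ι ι B}

lemma lastTwo_mul (M N : Matrix (ι × ι) (ι × ι) B) :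
    lastTwo n (M * N) = lastTwo n M * lastTwo n N := by
  simp only [← lastTwoHom_apply (K := ℤ), map_mul]

lemma lastTwo_one : lastTwo n (1 : Matrix (ι × ι) (ι × ι) B) = 1 := by
  rw [← lastTwoHom_apply (K := ℤ), map_one]

lemma extend_one : extend (1 : Matrix (Fin n → ι) (Fin n → ι) B) = 1 := by
  rw [← extendHom_apply (K := ℤ), map_one]

lemma isExchangePair_inv (hYB : IsYangBaxter ρ.val) (hD : IsQTraceMatrix ρ.val D) :
    IsExchangePair D ρ.val ρ⁻¹.val := by
  have h0 := braid_lastTwo hYB 0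
  refine hD.isExchangePair ρ.inv_mul ?_
  have h1 : lastTwo 1 ρ.val * lastTwo 1 ρ⁻¹.val = 1 := by
    rw [← lastTwo_mul, ρ.mul_inv, lastTwo_one]
  have h2 : extend (lastTwo 0 ρ⁻¹.val) * extend (lastTwo 0 ρ.val) = 1 := by
    rw [← extend_mul, ← lastTwo_mul, ρ.inv_mul, lastTwo_one, extend_one]
  generalize lastTwo 1 ρ.val = b at *
  generalize extend (lastTwo 0 ρ.val) = a at *
  calc _ = extend (lastTwo 0 ρ⁻¹.val) * a * b * a * lastTwo 1 ρ⁻¹.val := by rw [h2, one_mul]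
    _ = extend (lastTwo 0 ρ⁻¹.val) * (a * b * a) * lastTwo 1 ρ⁻¹.val := by
      simp only [mul_assoc]
    _ = extend (lastTwo 0 ρ⁻¹.val) * b * a * (b * lastTwo 1 ρ⁻¹.val) := by
      rw [h0]; simp only [mul_assoc]
    _ = _ := by rw [h1, mul_one]

lemma isExchangePair_inv' (hYB : IsYangBaxter ρ.val) (hD : IsQTraceMatrix ρ.val D) :
    IsExchangePair D ρ⁻¹.val ρ.val := by
  have h0 := braid_lastTwo hYB 0
  refine hD.isExchangePair ρ.mul_inv ?_
  have h1 : lastTwo 1 ρ⁻¹.val * lastTwo 1 ρ.val = 1 := by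
    rw [← lastTwo_mul, ρ.inv_mul, lastTwo_one]
  have h2 : extend (lastTwo 0 ρ.val) * extend (lastTwo 0 ρ⁻¹.val) = 1 := by
    rw [← extend_mul, ← lastTwo_mul, ρ.mul_inv, lastTwo_one, extend_one]
  generalize lastTwo 1 ρ.val = b at *
  generalize extend (lastTwo 0 ρ.val) = a at *
  calc _ = lastTwo 1 ρ⁻¹.val * a * b * (a * extend (lastTwo 0 ρ⁻¹.val)) := by rw [h2, mul_one]
    _ = lastTwo 1 ρ⁻¹.val * (a * b * a) * extend (lastTwo 0 ρ⁻¹.val) := by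
      simp only [mul_assoc]
    _ = (lastTwo 1 ρ⁻¹.val * b) * a * b * extend (lastTwo 0 ρ⁻¹.val) := by
      rw [h0]; simp only [mul_assoc]
    _ = _ := by rw [h1, one_mul]

lemma genUnit_mem_qCyclic (hYB : IsYangBaxter ρ.val) (hD : IsQTraceMatrix ρ.val D) {i : ℕ}
    (hi : i < n) : (genUnit B ρ n i).val ∈ qCyclic B (n + 1) D := by
  induction n with
  | zero => omega
  | succ n ih =>
    rcases Nat.lt_succ_iff_lt_or_eq.1 hi with hi | rfl
    · rw [val_genUnit_of_lt hi]
      exact extend_mem_qCyclic (ih hi)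
    · rw [val_genUnit_last]
      exact lastTwo_mem_qCyclic (Commute.units_inv_right_iff.1 (hD.kronecker_commute
        (isExchangePair_inv hYB hD) (isExchangePair_inv' hYB hD)))

lemma wordUp_mem_qCyclic (hYB : IsYangBaxter ρ.val) (hD : IsQTraceMatrix ρ.val D) {k : ℕ}
    (hk : k ≤ n) : (wordUp (genUnit B ρ n) k).val ∈ qCyclic B (n + 1) D := by
  induction k with
  | zero => exact Subalgebra.one_mem _
  | succ k ih =>
    rw [wordUp, Units.val_mul]
    exact Subalgebra.mul_mem _ (ih (by omega)) (genUnit_mem_qCyclic hYB hD (by omega))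

/-- Peels one letter off a conjugating word: tracing out the last copy removes the exchange pair,
while `V` and `W`, which do not act there, remain. -/
lemma qTraceTail_conj {M N : Matrix (ι × ι) (ι × ι) K} (h : IsExchangePair D M N)
    (V W Z : Matrix (Fin (n + 1) → ι) (Fin (n + 1) → ι) B) :
    qTraceTail D (extend V * scalars B (lastTwo n M) * extend Z *
      (scalars B (lastTwo n N) * extend W)) = qTraceTail D (V * extend (ptrLast D Z) * W) := by
  rw [← qTraceTail_ptrLast, ← mul_assoc, ptrLast_mul_extend, mul_assoc, mul_assoc,
    ptrLast_extend_mul, ← mul_assoc (scalars B _), h.ptrLast_conj]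

lemma qTraceTail_extend_zero (Z : Matrix (Fin 0 → ι) (Fin 0 → ι) B) :
    qTraceTail D (extend Z) = Matrix.diagonal fun _ => qTrace D Z := by
  ext i j
  simp [qTraceTail, qTrace, extend, Matrix.diagonal_apply, Subsingleton.elim _ Fin.elim0]

lemma qTraceTail_conj_wordUp (h : IsExchangePair D ρ.val ρ⁻¹.val)
    (Z : Matrix (Fin n → ι) (Fin n → ι) B) :
    qTraceTail D ((wordUp (genUnit B ρ n) n).val * extend Z * (wordUp (genUnit B ρ n) n)⁻¹.val) =
      Matrix.diagonal fun _ => qTrace D Z := by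
  induction n with
  | zero =>
    rw [wordUp, inv_one, Units.val_one, one_mul, mul_one, qTraceTail_extend_zero]
  | succ n ih =>
    rw [wordUp, mul_inv_rev, Units.val_mul, Units.val_mul, wordUp_genUnit_succ le_rfl,
      val_extendUnit, val_extendUnit_inv, val_genUnit_last, val_genUnit_last_inv,
      qTraceTail_conj h, ih, qTrace_ptrLast]

lemma qTraceTail_conj_wordDown (h : IsExchangePair D ρ⁻¹.val ρ.val)
    (Z : Matrix (Fin n → ι) (Fin n → ι) B) :
    qTraceTail D ((wordDown (genUnit B ρ n) n)⁻¹.val * extend Z *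
      (wordDown (genUnit B ρ n) n).val) = Matrix.diagonal fun _ => qTrace D Z := by
  induction n with
  | zero =>
    rw [wordDown, inv_one, Units.val_one, one_mul, mul_one, qTraceTail_extend_zero]
  | succ n ih =>
    rw [wordDown, mul_inv_rev, Units.val_mul, Units.val_mul, wordDown_genUnit_succ le_rfl,
      val_extendUnit, val_extendUnit_inv, val_genUnit_last, val_genUnit_last_inv,
      qTraceTail_conj h, ih, qTrace_ptrLast]

/-- The `q`-trace over all copies of `A_{n+1} L_{\bar 1} ⋯ L_{\bar{n+1}}`. -/
def traceAux (q : K) (ρ : (Matrix (ι × ι) (ι × ι) K)ˣ) (D : Matrix ι ι K) (L : Matrix ι ι B)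
    (n : ℕ) : B :=
  qTrace D (scalars B (antisymmetrizer q ρ.val n) * LbarProd ρ.val L n)

lemma extend_scalars_antisymmetrizer_mul :
    extend (scalars B (antisymmetrizer q ρ.val n) * LbarProd ρ.val L n) =
      antisym q (fun i => (genUnit B ρ (n + 1) i).val) n *
        barProd (genUnit B ρ (n + 1)) (firstHom K ι B (n + 1) L) n := by
  rw [extend_mul, scalars_antisymmetrizer, LbarProd_eq_barProd, extend_antisym q le_rfl,
    extend_barProd L le_rfl]

lemma mul_diagonal_traceAux (hYB : IsYangBaxter ρ.val)
    (hq : ρ.val * ρ.val = (q - q⁻¹) • ρ.val + 1) (hL : rlrlLeft ρ.val L = rlrlRight ρ.val L)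
    (hD : IsQTraceMatrix ρ.val D) (n : ℕ) :
    L * Matrix.diagonal (fun _ => traceAux q ρ D L n) =
      qTraceTail D (antisym q (fun i => (genUnit B ρ (n + 1) (i + 1)).val) n *
        barProd (genUnit B ρ (n + 1)) (firstHom K ι B (n + 1) L) (n + 1)) := by
  rw [traceAux, ← qTraceTail_conj_wordUp (isExchangePair_inv hYB hD), ← qTraceTail_firstHom_mul,
    extend_scalars_antisymmetrizer_mul,
    (isReflectionFamily_genUnit hYB hq hL (n + 1)).elem_mul_conj_wordUp]

lemma diagonal_traceAux_mul (hYB : IsYangBaxter ρ.val)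
    (hq : ρ.val * ρ.val = (q - q⁻¹) • ρ.val + 1) (hL : rlrlLeft ρ.val L = rlrlRight ρ.val L)
    (hD : IsQTraceMatrix ρ.val D) (n : ℕ) :
    Matrix.diagonal (fun _ => traceAux q ρ D L n) * L =
      qTraceTail D (antisym q (fun i => (genUnit B ρ (n + 1) (i + 1)).val) n *
        barProd (genUnit B ρ (n + 1)) (firstHom K ι B (n + 1) L) (n + 1)) := by
  rw [traceAux, ← qTraceTail_conj_wordDown (isExchangePair_inv' hYB hD), ← qTraceTail_mul_firstHom,
    extend_scalars_antisymmetrizer_mul,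
    (isReflectionFamily_genUnit hYB hq hL (n + 1)).conj_wordDown_mul_elem]

/-- Multiplying `L` by the scalar matrix of the trace gives the same matrix from either side;
entrywise this is commutation. -/
theorem sigma_commute (hYB : IsYangBaxter ρ.val)
    (hq : ρ.val * ρ.val = (q - q⁻¹) • ρ.val + 1) (hL : rlrlLeft ρ.val L = rlrlRight ρ.val L)
    (hD : IsQTraceMatrix ρ.val D) (j : ℕ) (a b : ι) :
    Commute (sigma q ρ.val D L j) (L a b) := by
  rcases j with _ | n
  · exact Commute.one_left _
  · have := congrFun (congrFun ((diagonal_traceAux_mul hYB hq hL hD n).trans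
      (mul_diagonal_traceAux hYB hq hL hD n).symm) a) b
    rw [Matrix.diagonal_mul, Matrix.mul_diagonal] at this
    exact Commute.smul_left this _

/-- The second term of the recursion for the wedge powers. -/
lemma qTraceTail_antisym_mul_first (hq0 : q ≠ 0) (hqr : ∀ n : ℕ, 1 ≤ n → q ^ n ≠ 1)
    (hYB : IsYangBaxter ρ.val)
    (hq : ρ.val * ρ.val = (q - q⁻¹) • ρ.val + 1) (hL : rlrlLeft ρ.val L = rlrlRight ρ.val L)
    (hD : IsQTraceMatrix ρ.val D) (n : ℕ) :
    qTraceTail D (antisym q (fun i => (genUnit B ρ (n + 1) (i + 1)).val) n *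
      (genUnit B ρ (n + 1) 0).val *
        barProd (genUnit B ρ (n + 1)) (firstHom K ι B (n + 1) L) (n + 1)) =
      L * wedgePower q ρ.val D L n := by
  have hf := isReflectionFamily_genUnit hYB hq hL (n + 1)
  have hH := isHeckeFamily_genUnit (B := B) hYB hq (n + 1)
  have hH' := isHeckeFamily_genUnit (B := B) hYB hq n
  have hc : (-q) ^ n * (-q⁻¹) ^ n = 1 := by
    rw [← mul_pow, neg_mul_neg, mul_inv_cancel₀ hq0, one_pow]
  have hshift : ∀ k ≤ n, wordUp (fun i => genUnit B ρ (n + 1) (i + 1)) k =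
      Units.map (MonoidHomClass.toMonoidHom (shiftHom K ι B (n + 1)))
        (wordUp (genUnit B ρ n) k) := fun k hk =>
    (wordUp_congr fun i hi => genUnit_shift (by omega)).trans (map_wordUp _ k).symm
  -- Each letter acts on the antisymmetrizer by `-q⁻¹`, so the inverse of a word of length `n` acts
  -- by `(-q) ^ n`.
  have hinv : (wordUp (fun i => genUnit B ρ (n + 1) (i + 1)) n)⁻¹.val *
      antisym q (fun i => (genUnit B ρ (n + 1) (i + 1)).val) n =
      (-q) ^ n • antisym q (fun i => (genUnit B ρ (n + 1) (i + 1)).val) n := by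
    rw [Units.inv_mul_eq_iff_eq_mul, mul_smul_comm,
      wordUp_mul_of_absorb (hH.shift.mul_antisym hq0 hqr), smul_smul, hc, one_smul]
  have hU : (wordUp (genUnit B ρ (n + 1)) (n + 1)).val =
      extend (wordUp (genUnit B ρ n) n).val * scalars B (lastTwo n ρ.val) := by
    rw [wordUp, Units.val_mul, wordUp_genUnit_succ le_rfl, val_extendUnit, val_genUnit_last]
  have hcomm := (hf.elem_commute_antisym (q := q)).eq
  have hsemi := (hf.wordUp_semiconj_antisym (q := q)).eq
  have hX := extend_scalars_antisymmetrizer_mul (q := q) (ρ := ρ) (n := n) (L := L)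
  rw [hf.antisym_mul_first_mul_barProd, hshift n le_rfl]
  rw [← map_inv]
  change qTraceTail D (_ * shiftHom K ι B (n + 1) (wordUp (genUnit B ρ n) n)⁻¹.val) = _
  -- The inverse word avoids the first copy, so it cycles to the front and meets the
  -- antisymmetrizer.
  rw [← qTraceTail_mul_comm (inv_mem_qCyclic (wordUp_mem_qCyclic hYB hD le_rfl))]
  change qTraceTail D ((Units.map (MonoidHomClass.toMonoidHom (shiftHom K ι B (n + 1)))
    (wordUp (genUnit B ρ n) n)⁻¹).val * _) = _
  -- Absorption gives `(-q) ^ n`. The antisymmetrizer passes `ℓ` and, through `U`, moves into the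
  -- first copies; the defining equation of `D` removes the last letter of `U`, and the other `n`
  -- letters give the cancelling `(-q⁻¹) ^ n`.
  rw [map_inv, ← hshift n le_rfl, ← mul_assoc, hinv, smul_mul_assoc, qTraceTail_smul,
    ← mul_assoc, ← hcomm, mul_assoc, ← mul_assoc _ (wordUp _ _).val, ← hsemi, mul_assoc, ← hX,
    qTraceTail_firstHom_mul, ← qTraceTail_ptrLast, hU, mul_assoc, ptrLast_extend_mul,
    ptrLast_mul_extend, hD.ptrLast_lastTwo, one_mul, scalars_antisymmetrizer, ← mul_assoc,
    wordUp_mul_of_absorb (hH'.mul_antisym hq0 hqr), smul_mul_assoc, qTraceTail_smul,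
    mul_smul_comm, smul_smul, hc, one_smul, wedgePower, scalars_antisymmetrizer]

lemma wedgePower_zero : wedgePower q ρ.val D L 0 = L := by
  ext i j
  simp [wedgePower, antisymmetrizer, LbarProd, qTraceTail, Lbar, ← scalarsHom_apply]

theorem wedgePower_succ (hq0 : q ≠ 0) (hqr : ∀ n : ℕ, 1 ≤ n → q ^ n ≠ 1)
    (hYB : IsYangBaxter ρ.val)
    (hq : ρ.val * ρ.val = (q - q⁻¹) • ρ.val + 1) (hL : rlrlLeft ρ.val L = rlrlRight ρ.val L)
    (hD : IsQTraceMatrix ρ.val D) (n : ℕ) :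
    qNumber q (n + 2) • wedgePower q ρ.val D L (n + 1) =
      sigma q ρ.val D L (n + 1) • L - L * (qNumber q (n + 1) • wedgePower q ρ.val D L n) := by
  have hf := isReflectionFamily_genUnit hYB hq hL (n + 1)
  have hH := isHeckeFamily_genUnit (B := B) hYB hq (n + 1)
  have hA : antisym q (fun i => (genUnit B ρ n i).val) n ∈ qCyclic B (n + 1) D :=
    antisym_mem _ q fun i hi => genUnit_mem_qCyclic hYB hD hi
  have hAA := hH.shift.antisym_mul_self hq0 hqr
  have hAP : Commute (antisym q (fun i => (genUnit B ρ (n + 1) (i + 1)).val) n)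
      (barProd (genUnit B ρ (n + 1)) (firstHom K ι B (n + 1) L) (n + 1)) :=
    (antisym_commute fun i hi => (hf.commute_barProd (by omega) le_rfl).symm).symm
  have hsig : sigma q ρ.val D L (n + 1) • L =
      q ^ (n + 1) • (Matrix.diagonal (fun _ => traceAux q ρ D L n) * L) := by
    ext a b
    simp [sigma, traceAux, Matrix.diagonal_mul]
  rw [hsig, diagonal_traceAux_mul hYB hq hL hD, mul_smul_comm,
    ← qTraceTail_antisym_mul_first hq0 hqr hYB hq hL hD, ← qTraceTail_smul, ← qTraceTail_smul,
    ← qTraceTail_sub, wedgePower, scalars_antisymmetrizer, LbarProd_eq_barProd,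
    hH.antisym_succ hq0 hqr, smul_mul_assoc, qTraceTail_smul, smul_smul,
    mul_inv_cancel₀ (qNumber_ne_zero hq0 hqr (n + 1)), one_smul]
  -- The right outer antisymmetrizer passes the product and cycles to the front, where idempotence
  -- merges it with the left one.
  rw [mul_assoc, hAP.eq, ← mul_assoc]
  rw [← shiftHom_antisym, ← qTraceTail_mul_comm hA, shiftHom_antisym]
  rw [← mul_assoc, ← mul_assoc, hAA, mul_sub, sub_mul, mul_smul_comm, mul_smul_comm,
    smul_mul_assoc, smul_mul_assoc, mul_one, hAP.eq]

theorem wedgePower_eq_sum (hq0 : q ≠ 0) (hqr : ∀ n : ℕ, 1 ≤ n → q ^ n ≠ 1)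
    (hYB : IsYangBaxter ρ.val)
    (hq : ρ.val * ρ.val = (q - q⁻¹) • ρ.val + 1) (hL : rlrlLeft ρ.val L = rlrlRight ρ.val L)
    (hD : IsQTraceMatrix ρ.val D) (n : ℕ) :
    qNumber q (n + 1) • wedgePower q ρ.val D L n =
      -∑ j ∈ Finset.range (n + 1), sigma q ρ.val D L j • (-L) ^ (n + 1 - j) := by
  induction n with
  | zero => simp [wedgePower_zero, qNumber_one (sub_inv_ne_zero hq0 hqr), sigma]
  | succ n ih =>
    have hsig : ∀ j (M : Matrix ι ι B), L * (sigma q ρ.val D L j • M) =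
        sigma q ρ.val D L j • (L * M) := by
      intro j M
      ext a b
      simp only [Matrix.mul_apply, Matrix.smul_apply, smul_eq_mul, Finset.mul_sum, ← mul_assoc,
        (sigma_commute hYB hq hL hD j a _).eq]
    -- The recursion supplies the new term `j = n + 1`; every earlier term gains a factor `-L`,
    -- which passes `σ_j` by `hsig`, that is, by centrality.
    rw [wedgePower_succ hq0 hqr hYB hq hL hD, ih, Finset.sum_range_succ _ (n + 1), mul_neg,
      Finset.mul_sum, Nat.add_sub_cancel_left, pow_one, neg_add, smul_neg, neg_neg, sub_neg_eq_add,
      add_comm, ← Finset.sum_neg_distrib]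
    congr 1
    refine Finset.sum_congr rfl fun j hj => ?_
    rw [hsig, show n + 1 + 1 - j = (n + 1 - j) + 1 by
      have := Finset.mem_range.1 hj; omega, pow_succ', neg_mul, smul_neg, neg_neg]

end Main

/-! ### Passage to the RLRL-algebra -/

section RLRL

variable {K : Type u} [Field K] {ι : Type v} [Fintype ι] [DecidableEq ι]

lemma scalars_map {X : Type*} {B B' : Type*} [Ring B] [Algebra K B] [Ring B'] [Algebra K B']
    (f : B →ₐ[K] B') (M : Matrix X X K) : (scalars B M).map f = scalars B' M := by
  ext x y
  simp [scalars_apply]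

lemma rlrl_generatingMatrix (R : Matrix (ι × ι) (ι × ι) K) :
    rlrlLeft R (generatingMatrix R) = rlrlRight R (generatingMatrix R) := by
  set f := RingQuot.mkAlgHom K (RLRLRel R)
  have hL : (freeMatrix K ι ⊗ₖ (1 : Matrix ι ι (FreeAlgebra K (ι × ι)))).map f =
      generatingMatrix R ⊗ₖ (1 : Matrix ι ι (RLRLAlgebra R)) := by
    ext x y
    simp only [Matrix.map_apply, Matrix.kroneckerMap_apply, map_mul, Matrix.one_apply]
    split_ifs <;> simp [freeMatrix, generatingMatrix, f]
  have h1 : (rlrlLeft R (freeMatrix K ι)).map f = rlrlLeft R (generatingMatrix R) := by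
    simp only [rlrlLeft, Matrix.map_mul, scalars_map, hL]
  have h2 : (rlrlRight R (freeMatrix K ι)).map f = rlrlRight R (generatingMatrix R) := by
    simp only [rlrlRight, Matrix.map_mul, scalars_map, hL]
  rw [← h1, ← h2]
  ext a b
  exact RingQuot.mkAlgHom_rel K (RLRLRel.entry a b)

lemma mem_center_of_commute (R : Matrix (ι × ι) (ι × ι) K) {z : RLRLAlgebra R}
    (h : ∀ a b, Commute z (generatingMatrix R a b)) : z ∈ Subalgebra.center K (RLRLAlgebra R) := by
  rw [Subalgebra.mem_center_iff]
  intro b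
  obtain ⟨x, rfl⟩ := RingQuot.mkAlgHom_surjective K (RLRLRel R) b
  induction x using FreeAlgebra.induction with
  | grade0 r => rw [AlgHom.commutes, Algebra.commutes]
  | grade1 p => exact (h p.1 p.2).eq.symm
  | mul x y hx hy => rw [map_mul, mul_assoc, hy, ← mul_assoc, hx, mul_assoc]
  | add x y hx hy => rw [map_add, add_mul, mul_add, hx, hy]

end RLRL

end QCHN

end

theorem mainTheorem3 {K : Type*} [Field K] {ι : Type*} [Fintype ι] [DecidableEq ι]
    (q : K) (hq0 : q ≠ 0) (hq : ∀ n : ℕ, 1 ≤ n → q ^ n ≠ 1)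
    (R : Matrix (ι × ι) (ι × ι) K) (hYB : QCHN.IsYangBaxter R) (hHecke : QCHN.IsHecke q R)
    (D : Matrix ι ι K) (hD : QCHN.IsQTraceMatrix R D) :
    (∀ n : ℕ,
      QCHN.qNumber q (n + 1) • QCHN.wedgePower q R D (QCHN.generatingMatrix R) n =
        -∑ j ∈ Finset.range (n + 1),
          QCHN.sigma q R D (QCHN.generatingMatrix R) j •
            (-QCHN.generatingMatrix R) ^ (n + 1 - j)) ∧
    ∀ j : ℕ, QCHN.sigma q R D (QCHN.generatingMatrix R) j ∈
      Subalgebra.center K (QCHN.RLRLAlgebra R) := by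
  refine ⟨fun n => ?_, fun j => ?_⟩
  · exact QCHN.wedgePower_eq_sum (ρ := QCHN.heckeUnit hq0 hHecke) hq0 hq hYB
      (hHecke.mul_self hq0) (QCHN.rlrl_generatingMatrix R) hD n
  · exact QCHN.mem_center_of_commute R fun a b =>
      QCHN.sigma_commute (ρ := QCHN.heckeUnit hq0 hHecke) hYB (hHecke.mul_self hq0)
        (QCHN.rlrl_generatingMatrix R) hD j a b
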